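/- **Setting.** Let $H$ be a separable real Hilbert space, $T>0$, $D\subset H$ convex, and $\mathcal E:[0,T]\times D\to\mathbb R$, $\mathcal E_t(u)=\mathcal E(t,u)$, extended by $+\infty$ for $u\notin D$. Put $\overline{\mathcal E}=\mathcal E-\inf\mathcal E+1$ and $S_\rho=\{u\in D:\overline{\mathcal E}_t(u)\le\rho\ \forall t\in[0,T]\}$. Assume: (E.1) the sublevels of $\mathcal E$ in $[0,T]\times D$ are compact; (E.2) $\mathcal P_t(u):=\partial_t\mathcal E_t(u)$ exists on $[0,T]\times D$ (one-sided at $0,T$), $|\mathcal P_t(u)|\le C_P\overline{\mathcal E}_t(u)$ for some $C_P\ge0$, and $u_n\to u$ in $H$ with $u_n,u\in D$, $\sup_n\mathcal E_t(u_n)<\infty$ implies $\mathcal P_t(u_n)\to\mathcal P_t(u)$; (E.3) for some $\lambda\ge 0$ all the maps $u\mapsto\mathcal E_t(u)+\frac\lambda2\|u\|^2$ are convex on $D$. Let $\partial\mathcal E_t$ be the Fréchet subdifferential in $H$, $|\partial^\circ\mathcal E_t|(u)=\min\{\|\xi\|:\xi\in\partial\mathcal E_t(u)\}$ ($+\infty$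 if $\partial\mathcal E_t(u)=\emptyset$; $0\cdot\infty=0$ below), and $C(t)=\{u\in D:0\in\partial\mathcal E_t(u)\}$. Let $X$ be a separable Banach space, continuously and densely included in $H$, $Y$ a Banach space continuously included in $H$, and $O\subset X\cap D$ open and connected in $X$. Assume: if $u\in C(t)$ then $u\in O$ and $\partial\mathcal E_t(u)=\{0\}$; $\mathcal E\in C^3([0,T]\times O)$; for $(t,u)\in[0,T]\times O$ the differential of $\mathcal E_t|_O$ at $u$ is represented, via the inner product of $H$, by an element $\mathrm D\mathcal E_t(u)\in Y$, the map $\mathrm D\mathcal E:[0,T]\times O\to Y$ is of class $C^2$, and each $\mathrm D\mathcal E_t:O\to Y$ is a Fredholm map of index $0$; for every $\rho>0$, if $u_n\in C(t_n)\cap S_\rho$, $u\in C(t)\cap S_\rho$, $t_n\to t$ and $u_n\to u$ in $H$, then $u_n\to u$ in $X$; for $(t,u)\in[0,T]\times O$ the operator $\mathrm D^2\mathcal E_t(u)\in\mathcal L(X;Y)$ has a (necessarily unique) continuous extension $\tilde L\in\mathcal L(H;H)$, and $\{h\in H:\tilde Lh\in Y\}\subset X$. Let $S(t)$ be the set of $u\in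 C(t)$ with $\mathrm D^2\mathcal E_t(u)$ non-invertible (degenerate critical points). Assume the full set of transversality conditions: for all $t\in[0,T]$ and $u\in S(t)$, with $N=\ker\mathrm D^2\mathcal E_t(u)$: (T.1) $\dim N=1$; (T.2) $\langle\partial_t\mathrm D\mathcal E_t(u),v\rangle\ne0$ for $0\ne v\in N$; (T.3) $\mathrm D^3\mathcal E_t(u)[v,v,v]\neq0$ for $0\ne v\in N$. **Transitions and cost.** An admissible transition at time $t$ between $U_0,U_1\subset H$ is a map $\vartheta:[0,1]\to D$ with $\vartheta(0)\in U_0$, $\vartheta(1)\in U_1$ such that: $G_t[\vartheta]=\{s:\vartheta(s)\notin C(t)\}$ is relatively open in $[0,1]$, $\vartheta$ is locally Lipschitz on it and $|\partial^\circ\mathcal E_t|(\vartheta)\,\|\vartheta'\|$ is essentially bounded on it; $s\mapsto\mathcal E_t(\vartheta(s))$ is Lipschitz; for $r\notin G_t[\vartheta]$ all limit points of $\vartheta(s)$ as $s\to r$ lie in the connected component of $C(t)$ containing $\vartheta(r)$. The cost $c_t(U_0,U_1)$ is the infimum of $\int_{G_t[\vartheta]}|\partial^\circ\mathcal E_t|(\vartheta)\|\vartheta'\|\,ds$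 over such $\vartheta$ ($+\infty$ if there is none). **Solutions.** For $u:[0,T]\to D$ let $e(t)=\mathcal E_t(u(t))$, and let $U(t)$ be the connected component of $C(t)$ containing $u(t)$ if $u(t)\in C(t)$, and $\{u(t)\}$ otherwise. A Borel map $u$ is a Dissipative Viscosity solution with dissipation measure $\mu$, a finite nonnegative Borel measure on $[0,T]$, and jump set $J=\{t:\mu(\{t\})>0\}$, if: 1. $e$ has bounded variation, $\mu([s,t])+e(t)=e(s)+\int_s^t\mathcal P_r(u(r))\,dr$ for all $s\le t$ in $[0,T]\setminus J$, and $J=\{t\in[0,T]:e(t-)\ne e(t+)\}$, where $e(0-):=e(0)$ and $e(T+):=e(T)$; 2. for $t\in[0,T]\setminus J$: $u(t)\in C(t)$, and all limit points of $u(s)$ as $s\to t$ lie in $U(t)$; 3. for every $t\in J$ there is a unique pair of connected components $U(t-),U(t+)$ of $C(t)$ such that $U(t\pm)$ contains all limit points of $u(s)$ as $s\to t^\pm$, $\mathcal E_t=e(t\pm)$ on $U(t\pm)$, and $0<c_t(U(t-),U(t+))=c_t(U(t-),U(t))+c_t(U(t),U(t+))=e(t-)-e(t+)=\mu(\{t\})$;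 at the end points the missing limits are replaced by $U(0-):=U(0)$, $U(T+):=U(T)$. **Theorem.** Let $u$ be a Dissipative Viscosity solution with jump set $J$. Then: 1. for every $t\in(0,T)$ the left limit $u(t-)$ exists in $H$, and if $u(t-)\in S(t)$ then $t\in J$; 2. $J$ is finite. -/

import Mathlib

open Set Filter Topology MeasureTheory

namespace CriticalEvolution

noncomputable section

section Energy

variable {H : Type*} [NormedAddCommGroup H] [InnerProductSpace ℝ H]

/- Throughout, the time-dependent energy is given by a final time `T`, a convex set `D` of `H` and a
function `E : ℝ → H → ℝ`, of which only the values `E t u` with `t ∈ [0,T]` and `u ∈ D` matter: the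
energy is understood to be `+∞` at `u ∉ D`. -/

/-- The Fréchet subdifferential at `u` of the functional equal to `F` on `D` and to `+∞` off `D`:
`ξ ∈ ∂F(u)` iff `u ∈ D` and `F v - F u ≥ ⟨ξ, v - u⟩ + o(‖v - u‖)` as `v → u`. -/
def frechetSubdiff (D : Set H) (F : H → ℝ) (u : H) : Set H :=
  {ξ | u ∈ D ∧ ∀ ε > 0, ∀ᶠ v in 𝓝[D] u, inner ℝ ξ (v - u) - ε * ‖v - u‖ ≤ F v - F u}

/-- The norm of the minimal element of the Fréchet subdifferential, `+∞` if the latter is empty. -/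
def minSlope (D : Set H) (F : H → ℝ) (u : H) : ENNReal :=
  ⨅ ξ ∈ frechetSubdiff D F u, ‖ξ‖ₑ

/-- The set of critical points of `E t`. -/
def crit (D : Set H) (E : ℝ → H → ℝ) (t : ℝ) : Set H :=
  {u | u ∈ D ∧ (0 : H) ∈ frechetSubdiff D (E t) u}

/-- The partial derivative in time of the energy (one-sided at `0` and `T`). -/
def power (T : ℝ) (E : ℝ → H → ℝ) (t : ℝ) (u : H) : ℝ :=
  derivWithin (fun s => E s u) (Icc 0 T) t

/-- The energy translated so that its minimum over `[0,T] × D` is `1`. -/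
def shifted (T : ℝ) (D : Set H) (E : ℝ → H → ℝ) (t : ℝ) (u : H) : ℝ :=
  E t u - sInf ((fun p : ℝ × H => E p.1 p.2) '' (Icc 0 T ×ˢ D)) + 1

/-- The points whose translated energy is at most `ρ` at all times. -/
def sublevel (T : ℝ) (D : Set H) (E : ℝ → H → ℝ) (ρ : ℝ) : Set H :=
  {u | u ∈ D ∧ ∀ t ∈ Icc 0 T, shifted T D E t u ≤ ρ}

/-- The standing assumptions on the energy: compact sublevels in `[0,T] × D`, control and
conditional continuity of the power, and `(-lam)`-convexity in `u`, uniformly in time. -/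
structure IsAdmissibleEnergy (T : ℝ) (D : Set H) (E : ℝ → H → ℝ) : Prop where
  convex_domain : Convex ℝ D
  coercive : ∀ c : ℝ, IsCompact {p : ℝ × H | p.1 ∈ Icc 0 T ∧ p.2 ∈ D ∧ E p.1 p.2 ≤ c}
  time_differentiable : ∀ t ∈ Icc 0 T, ∀ u ∈ D,
    DifferentiableWithinAt ℝ (fun s => E s u) (Icc 0 T) t
  power_bound : ∃ CP : ℝ, 0 ≤ CP ∧ ∀ t ∈ Icc 0 T, ∀ u ∈ D,
    |power T E t u| ≤ CP * shifted T D E t u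
  power_continuous : ∀ t ∈ Icc 0 T, ∀ (w : ℕ → H) (u : H), (∀ n, w n ∈ D) → u ∈ D →
    Tendsto w atTop (𝓝 u) → BddAbove (range fun n => E t (w n)) →
    Tendsto (fun n => power T E t (w n)) atTop (𝓝 (power T E t u))
  semiconvex : ∃ lam : ℝ, 0 ≤ lam ∧ ∀ t ∈ Icc 0 T,
    ConvexOn ℝ D (fun u => E t u + lam / 2 * ‖u‖ ^ 2)

/-- Kuratowski upper limit along a filter of a single-valued map into `H`: its limit points. -/
def upperLim (l : Filter ℝ) (a : ℝ → H) : Set H := {x | MapClusterPt x l a}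

/-- `U` is a connected component of the critical set at time `t`. -/
def IsCritComponent (D : Set H) (E : ℝ → H → ℝ) (t : ℝ) (U : Set H) : Prop :=
  ∃ x ∈ crit D E t, U = connectedComponentIn (crit D E t) x

open Classical in
/-- The connected component of `x` in the critical set if `x` is critical, and `{x}` otherwise. -/
def lifting (D : Set H) (E : ℝ → H → ℝ) (t : ℝ) (x : H) : Set H :=
  if x ∈ crit D E t then connectedComponentIn (crit D E t) x else {x}

/-- The parameters in `[0,1]` at which the curve `θ` is not at a critical point. -/
def noncritParams (D : Set H) (E : ℝ → H → ℝ) (t : ℝ) (θ : ℝ → H) : Set ℝ :=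
  {s | s ∈ Icc 0 1 ∧ θ s ∉ crit D E t}

/-- Admissible transitions between `U₀` and `U₁` at the process time `t`; only the values of `θ`
on `[0,1]` matter. -/
structure IsAdmissibleTransition (D : Set H) (E : ℝ → H → ℝ) (t : ℝ) (U₀ U₁ : Set H)
    (θ : ℝ → H) : Prop where
  mapsTo : MapsTo θ (Icc 0 1) D
  left_mem : θ 0 ∈ U₀
  right_mem : θ 1 ∈ U₁
  rel_open : ∃ G : Set ℝ, IsOpen G ∧ noncritParams D E t θ = Icc 0 1 ∩ G
  locLipschitz : LocallyLipschitzOn (noncritParams D E t θ) θ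
  slope_bound : ∃ L : NNReal, ∀ᵐ s ∂(volume.restrict (noncritParams D E t θ)),
    minSlope D (E t) (θ s) * ‖deriv θ s‖ₑ ≤ L
  energy_lipschitz : ∃ K : NNReal, LipschitzOnWith K (fun s => E t (θ s)) (Icc 0 1)
  upperLim_subset : ∀ r ∈ Icc (0 : ℝ) 1, r ∉ noncritParams D E t θ →
    upperLim (𝓝[Icc 0 1 \ {r}] r) θ ⊆ connectedComponentIn (crit D E t) (θ r)

/-- The energy-dissipation cost, `+∞` if there are no admissible transitions. -/
def cost (D : Set H) (E : ℝ → H → ℝ) (t : ℝ) (U₀ U₁ : Set H) : ENNReal :=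
  ⨅ (θ : ℝ → H) (_ : IsAdmissibleTransition D E t U₀ U₁ θ),
    ∫⁻ s in noncritParams D E t θ, minSlope D (E t) (θ s) * ‖deriv θ s‖ₑ

/-- `l` is the left limit at `t` of `e : [0,T] → ℝ`, with the convention `e(0-) = e(0)`. -/
def IsLeftLim (e : ℝ → ℝ) (t l : ℝ) : Prop :=
  (t = 0 ∧ l = e 0) ∨ (0 < t ∧ Tendsto e (𝓝[Ico 0 t] t) (𝓝 l))

/-- `l` is the right limit at `t` of `e : [0,T] → ℝ`, with the convention `e(T+) = e(T)`. -/
def IsRightLim (T : ℝ) (e : ℝ → ℝ) (t l : ℝ) : Prop :=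
  (t = T ∧ l = e T) ∨ (t < T ∧ Tendsto e (𝓝[Ioc t T] t) (𝓝 l))

/-- `U` is a left trace at `t` of the curve `u`: a connected component of the critical set at `t`
that contains all limit points of `u(s)` as `s ↑ t` and on which `E t` takes the constant value
`e(t-)`, where `e(s) = E s (u s)`. At `t = 0`, where there is no left limit, it is the lifting of
`u(0)`. -/
def IsLeftTrace (D : Set H) (E : ℝ → H → ℝ) (u : ℝ → H) (t : ℝ) (U : Set H) : Prop :=
  (t = 0 ∧ U = lifting D E 0 (u 0)) ∨
  (0 < t ∧ IsCritComponent D E t U ∧ upperLim (𝓝[Ico 0 t] t) u ⊆ U ∧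
    ∀ x ∈ U, IsLeftLim (fun s => E s (u s)) t (E t x))

/-- `U` is a right trace at `t` of the curve `u`; at `t = T` it is the lifting of `u(T)`. -/
def IsRightTrace (T : ℝ) (D : Set H) (E : ℝ → H → ℝ) (u : ℝ → H) (t : ℝ) (U : Set H) : Prop :=
  (t = T ∧ U = lifting D E T (u T)) ∨
  (t < T ∧ IsCritComponent D E t U ∧ upperLim (𝓝[Ioc t T] t) u ⊆ U ∧
    ∀ x ∈ U, IsRightLim T (fun s => E s (u s)) t (E t x))

/-- The jump set: the times in `[0,T]` at which the measure `μ` has an atom. -/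
def jumpSet (T : ℝ) (μ : Measure ℝ) : Set ℝ := {t | t ∈ Icc 0 T ∧ 0 < μ {t}}

/-- `u : [0,T] → D` is a Dissipative Viscosity solution with dissipation measure `μ`. -/
structure IsDissipativeViscosity [MeasurableSpace H] (T : ℝ) (D : Set H) (E : ℝ → H → ℝ)
    (u : ℝ → H) (μ : Measure ℝ) : Prop where
  measurable : Measurable (fun t : Icc (0 : ℝ) T => u t)
  mapsTo : MapsTo u (Icc 0 T) D
  bounded_variation : BoundedVariationOn (fun t => E t (u t)) (Icc 0 T)
  finite_measure : IsFiniteMeasure μ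
  measure_support : μ (Icc 0 T)ᶜ = 0
  energy_balance : ∀ s ∈ Icc 0 T \ jumpSet T μ, ∀ t ∈ Icc 0 T \ jumpSet T μ, s ≤ t →
    μ.real (Icc s t) + E t (u t) = E s (u s) + ∫ r in s..t, power T E r (u r)
  jumpSet_eq : jumpSet T μ = {t | t ∈ Icc 0 T ∧ ∃ l r : ℝ,
    IsLeftLim (fun s => E s (u s)) t l ∧ IsRightLim T (fun s => E s (u s)) t r ∧ l ≠ r}
  critical : ∀ t ∈ Icc 0 T \ jumpSet T μ, u t ∈ crit D E t ∧
    upperLim (𝓝[Icc 0 T \ {t}] t) u ⊆ lifting D E t (u t)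
  jump : ∀ t ∈ jumpSet T μ, ∃! U : Set H × Set H,
    IsLeftTrace D E u t U.1 ∧ IsRightTrace T D E u t U.2 ∧
    0 < cost D E t U.1 U.2 ∧
    cost D E t U.1 U.2 =
      cost D E t U.1 (lifting D E t (u t)) + cost D E t (lifting D E t (u t)) U.2 ∧
    (∃ l r : ℝ, IsLeftLim (fun s => E s (u s)) t l ∧ IsRightLim T (fun s => E s (u s)) t r ∧
      cost D E t U.1 U.2 = ENNReal.ofReal (l - r)) ∧
    cost D E t U.1 U.2 = μ {t}

end Energy

section Smooth

variable {H X Y : Type*} [NormedAddCommGroup H] [InnerProductSpace ℝ H]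
  [NormedAddCommGroup X] [NormedSpace ℝ X] [NormedAddCommGroup Y] [NormedSpace ℝ Y]

/-- The smooth setting: `X` is densely and `Y` continuously included in `H` (through `i` and `j`),
the critical points lie in the connected open subset `O` of `X`, the energy is of class `C³` on
`[0,T] × O`, and `f t u ∈ Y` is its differential in `u`, of class `C²` as a `Y`-valued map, and a
Fredholm map of index `0` at fixed time. -/
structure IsSmoothSetting (T : ℝ) (D : Set H) (E : ℝ → H → ℝ) (i : X →L[ℝ] H) (j : Y →L[ℝ] H)
    (O : Set X) (f : ℝ → X → Y) : Prop where
  i_injective : Function.Injective i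
  i_dense : DenseRange i
  j_injective : Function.Injective j
  isOpen : IsOpen O
  isConnected : IsConnected O
  subset_domain : MapsTo i O D
  critical_regular : ∀ t ∈ Icc 0 T, ∀ u ∈ D, (0 : H) ∈ frechetSubdiff D (E t) u →
    u ∈ i '' O ∧ frechetSubdiff D (E t) u = {0}
  energy_contDiff : ContDiffOn ℝ 3 (fun p : ℝ × X => E p.1 (i p.2)) (Icc 0 T ×ˢ O)
  differential_eq : ∀ t ∈ Icc 0 T, ∀ x ∈ O, ∀ h : X,
    fderiv ℝ (fun w => E t (i w)) x h = inner ℝ (j (f t x)) (i h)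
  differential_contDiff : ContDiffOn ℝ 2 (fun p : ℝ × X => f p.1 p.2) (Icc 0 T ×ˢ O)
  fredholm : ∀ t ∈ Icc 0 T, ∀ x ∈ O, (fderiv ℝ (f t) x).IsFredholm
  index_zero : ∀ t ∈ Icc 0 T, ∀ x ∈ O,
    Module.finrank ℝ (fderiv ℝ (f t) x).ker = Module.finrank ℝ (Y ⧸ (fderiv ℝ (f t) x).range)
  critical_topology : ∀ ρ > 0, ∀ (τ : ℕ → ℝ) (w : ℕ → X) (t : ℝ) (x : X),
    (∀ n, τ n ∈ Icc 0 T ∧ i (w n) ∈ crit D E (τ n) ∩ sublevel T D E ρ) →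
    t ∈ Icc 0 T → i x ∈ crit D E t ∩ sublevel T D E ρ →
    Tendsto τ atTop (𝓝 t) → Tendsto (fun n => i (w n)) atTop (𝓝 (i x)) →
    Tendsto w atTop (𝓝 x)
  hessian_extension : ∀ t ∈ Icc 0 T, ∀ x ∈ O, ∃ L : H →L[ℝ] H,
    (∀ h : X, L (i h) = j (fderiv ℝ (f t) x h)) ∧ ∀ h : H, L h ∈ range j → h ∈ range i

/-- `x` is a degenerate critical point at time `t`: the second differential is not invertible. -/
def IsDegenerate (D : Set H) (E : ℝ → H → ℝ) (i : X →L[ℝ] H) (f : ℝ → X → Y)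
    (t : ℝ) (x : X) : Prop :=
  i x ∈ crit D E t ∧ ¬ (fderiv ℝ (f t) x).IsInvertible

/-- The full set of transversality conditions, at every degenerate critical point. -/
structure IsFullyTransversal (T : ℝ) (D : Set H) (E : ℝ → H → ℝ) (i : X →L[ℝ] H) (j : Y →L[ℝ] H)
    (f : ℝ → X → Y) : Prop where
  ker_dim : ∀ t ∈ Icc 0 T, ∀ x : X, IsDegenerate D E i f t x →
    Module.finrank ℝ (fderiv ℝ (f t) x).ker = 1
  time_transversal : ∀ t ∈ Icc 0 T, ∀ x : X, IsDegenerate D E i f t x →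
    ∀ v ∈ (fderiv ℝ (f t) x).ker, v ≠ 0 →
      inner ℝ (j (derivWithin (fun s => f s x) (Icc 0 T) t)) (i v) ≠ 0
  third_order : ∀ t ∈ Icc 0 T, ∀ x : X, IsDegenerate D E i f t x →
    ∀ v ∈ (fderiv ℝ (f t) x).ker, v ≠ 0 →
      iteratedFDeriv ℝ 3 (fun w => E t (i w)) x (fun _ => v) ≠ 0

end Smooth

end

end CriticalEvolution

/-! Critical points are zeros of `f t`. Near a nondegenerate one there is at most one zero at each
time. Near a degenerate one the conditions (T.1)-(T.3) make the zero set a fold: it looks like a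
parabola in (time, kernel direction), opening to one side of the time axis. The kernel vector v is
oriented so that the cubic form of (T.3) is positive, and φ is a functional with φ v = 1. The sign
of φ (x - x₀) then separates the two branches, and at equal times the positive branch has the
smaller energy (`IsFold.exists_structure`). All this comes from direct estimates on differences of
zeros; no parametrization of the branches is built.

Critical points are isolated, so the components of the critical set are points. Compactness of
sublevels then turns the conditions on limit points into genuine one-sided limits of u. These limits
are critical, they agree with u off the jump set, and the energy drops strictly between them at a
jump.

Near a one-sided limit of u at t₀, a jump can therefore only lead from the negative branch to the
positive one. Between jumps the sign cannot change, since it varies continuously and vanishes only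
at t₀. Hence each side of t₀ carries at most one jump close to t₀ (`subsingleton_of_sign_change`),
and compactness of [0,T] makes the jump set finite.

If u(t-) is degenerate and t is not a jump time, u is continuous at t. There are then critical
points near u(t-) both shortly before and shortly after t, which contradicts the one-sidedness of
the fold. -/

namespace CriticalEvolution

/-! ### Differential calculus within a locally convex set -/

section Calculus

variable {P W : Type*} [NormedAddCommGroup P] [NormedSpace ℝ P]
  [NormedAddCommGroup W] [NormedSpace ℝ W]

/-- A `C¹` map on a locally convex set is strictly differentiable within the set. -/
theorem exists_ball_norm_sub_fderivWithin_le {K : Set P} {G : P → W} {p₀ : P} {r : ℝ}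
    (hr : 0 < r) (hK : Convex ℝ (K ∩ Metric.ball p₀ r)) (hu : UniqueDiffOn ℝ K)
    (hp : p₀ ∈ K) (hG : ContDiffOn ℝ 1 G K) {ε : ℝ} (hε : 0 < ε) :
    ∃ δ > 0, ∀ p ∈ K ∩ Metric.ball p₀ δ, ∀ q ∈ K ∩ Metric.ball p₀ δ,
      ‖G p - G q - fderivWithin ℝ G K p₀ (p - q)‖ ≤ ε * ‖p - q‖ := by
  have hc : ContinuousWithinAt (fderivWithin ℝ G K) K p₀ :=
    (hG.continuousOn_fderivWithin hu le_rfl) p₀ hp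
  obtain ⟨δ, hδ, hb⟩ := Metric.continuousWithinAt_iff.1 hc ε hε
  refine ⟨min δ r, lt_min hδ hr, fun p hp q hq => ?_⟩
  have hconv : Convex ℝ (K ∩ Metric.ball p₀ (min δ r)) := by
    have : K ∩ Metric.ball p₀ (min δ r) = (K ∩ Metric.ball p₀ r) ∩ Metric.ball p₀ δ := by
      ext z; simp only [mem_inter_iff, Metric.mem_ball, lt_min_iff]; tauto
    rw [this]
    exact hK.inter (convex_ball _ _)
  refine hconv.norm_image_sub_le_of_norm_hasFDerivWithin_le' (f' := fderivWithin ℝ G K)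
    (fun z hz => ?_) (fun z hz => ?_) hq hp
  · exact ((hG.differentiableOn (by norm_num)) z hz.1).hasFDerivWithinAt.mono inter_subset_left
  · have := hb hz.1 (lt_of_lt_of_le (Metric.mem_ball.1 hz.2) (min_le_left _ _))
    rw [dist_eq_norm] at this
    exact this.le

/-- Chain rule along a segment contained in the set of differentiability. -/
theorem hasDerivAt_comp_segment {K : Set P} {G : P → W} {p q : P} (hpq : segment ℝ q p ⊆ K)
    (hG : DifferentiableOn ℝ G K) {r : ℝ} (hr : r ∈ Ioo (0 : ℝ) 1) :
    HasDerivAt (fun r : ℝ => G (q + r • (p - q)))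
      (fderivWithin ℝ G K (q + r • (p - q)) (p - q)) r := by
  have hm : MapsTo (fun r : ℝ => q + r • (p - q)) (Icc 0 1) K := fun s hs =>
    hpq (by rw [segment_eq_image']; exact ⟨s, hs, rfl⟩)
  have h1 : HasDerivAt (fun r : ℝ => q + r • (p - q)) (p - q) r := by
    simpa using ((hasDerivAt_id r).smul_const (p - q)).const_add q
  have h2 := (hG _ (hm (Ioo_subset_Icc_self hr))).hasFDerivWithinAt.comp_hasDerivWithinAt r
    (h1.hasDerivWithinAt (s := Icc 0 1)) hm
  exact h2.hasDerivAt (Icc_mem_nhds hr.1 hr.2)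

theorem continuousOn_comp_segment {Z : Type*} [TopologicalSpace Z] {K : Set P} {G : P → Z} {p q : P} (hpq : segment ℝ q p ⊆ K)
    (hG : ContinuousOn G K) : ContinuousOn (fun r : ℝ => G (q + r • (p - q))) (Icc 0 1) :=
  hG.comp (by fun_prop) fun s hs => hpq (by rw [segment_eq_image']; exact ⟨s, hs, rfl⟩)

/-- Rolle's theorem along a segment. -/
theorem exists_fderivWithin_segment_eq_zero {K : Set P} {G : P → W} {p q : P} (l : W →L[ℝ] ℝ)
    (hpq : segment ℝ q p ⊆ K) (hG : DifferentiableOn ℝ G K) (h : l (G p) = l (G q)) :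
    ∃ r ∈ Ioo (0 : ℝ) 1, l (fderivWithin ℝ G K (q + r • (p - q)) (p - q)) = 0 := by
  obtain ⟨r, hr, h0⟩ := exists_hasDerivAt_eq_zero (f := fun r : ℝ => l (G (q + r • (p - q))))
    (f' := fun r => l (fderivWithin ℝ G K (q + r • (p - q)) (p - q))) zero_lt_one
    (l.continuous.comp_continuousOn (continuousOn_comp_segment hpq hG.continuousOn))
    (by simp [h]) (fun r hr => l.hasFDerivAt.comp_hasDerivAt r (hasDerivAt_comp_segment hpq hG hr))
  exact ⟨r, hr, h0⟩

/-- A function on `[0,1]` vanishing at the end points with strictly increasing derivative is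
negative inside. -/
theorem neg_of_strictMono_deriv {g g' : ℝ → ℝ} (hc : ContinuousOn g (Icc 0 1))
    (hd : ∀ r ∈ Ioo (0 : ℝ) 1, HasDerivAt g (g' r) r) (h0 : g 0 = 0) (h1 : g 1 = 0)
    (hm : ∀ r ∈ Ioo (0 : ℝ) 1, ∀ r' ∈ Ioo (0 : ℝ) 1, r' < r → g' r' < g' r)
    {c : ℝ} (hcm : c ∈ Ioo (0 : ℝ) 1) : g c < 0 := by
  -- The mean slopes on [0,c] and [c,1] are g c / c and -g c / (1 - c); the first must be strictly
  -- smaller, which forces g c < 0.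
  obtain ⟨a, ha, ha'⟩ := exists_hasDerivAt_eq_slope g g' hcm.1
    (hc.mono (Icc_subset_Icc_right hcm.2.le)) (fun r hr => hd r ⟨hr.1, hr.2.trans hcm.2⟩)
  obtain ⟨b, hb, hb'⟩ := exists_hasDerivAt_eq_slope g g' hcm.2
    (hc.mono (Icc_subset_Icc_left hcm.1.le)) (fun r hr => hd r ⟨hcm.1.trans hr.1, hr.2⟩)
  have hab := hm b ⟨hcm.1.trans hb.1, hb.2⟩ a ⟨ha.1, ha.2.trans hcm.2⟩ (ha.2.trans hb.1)
  rw [ha', hb', h0, h1, sub_zero, sub_zero, zero_sub] at hab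
  by_contra hn
  push Not at hn
  have e1 : 0 ≤ g c / c := div_nonneg hn hcm.1.le
  have e2 : -g c / (1 - c) ≤ 0 := div_nonpos_of_nonpos_of_nonneg (by linarith) (by linarith [hcm.2])
  linarith

end Calculus

/-! ### Zero set near a fold point -/

section Fold

variable {X Y : Type*} [NormedAddCommGroup X] [NormedSpace ℝ X]
  [NormedAddCommGroup Y] [NormedSpace ℝ Y]

/-- Nondegeneracy data of a fold point `p₀` of the zero set of `G` in `K ⊆ ℝ × X`: the partial
differential in `X` has kernel spanned by `v`, range annihilated by `β v`, and the `t`-derivative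
and the second derivative along `v` are transversal to the range. -/
structure IsFold (K : Set (ℝ × X)) (G : ℝ × X → Y) (β : X →L[ℝ] Y →L[ℝ] ℝ) (φ : X →L[ℝ] ℝ)
    (v : X) (p₀ : ℝ × X) : Prop where
  mem : p₀ ∈ K
  uniqueDiffOn : UniqueDiffOn ℝ K
  locally_convex : ∃ r > 0, Convex ℝ (K ∩ Metric.ball p₀ r)
  contDiffOn : ContDiffOn ℝ 2 G K
  zero : G p₀ = 0
  normalized : φ v = 1
  kernel : fderivWithin ℝ G K p₀ (0, v) = 0
  range : ∀ h : X, β v (fderivWithin ℝ G K p₀ (0, h)) = 0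
  lower : ∃ C > 0, ∀ p : ℝ × X, ‖p‖ ≤ C * (‖fderivWithin ℝ G K p₀ p‖ + |φ p.2|)
  second : 0 < β v (fderivWithin ℝ (fderivWithin ℝ G K) K p₀ (0, v) (0, v))

variable {K : Set (ℝ × X)} {G : ℝ × X → Y} {β : X →L[ℝ] Y →L[ℝ] ℝ} {φ : X →L[ℝ] ℝ}
  {v : X} {p₀ : ℝ × X}

namespace IsFold

theorem contDiffOn_fderivWithin (hF : IsFold K G β φ v p₀) :
    ContDiffOn ℝ 1 (fderivWithin ℝ G K) K :=
  hF.contDiffOn.fderivWithin hF.uniqueDiffOn (by norm_num)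

theorem differentiableOn (hF : IsFold K G β φ v p₀) : DifferentiableOn ℝ G K :=
  hF.contDiffOn.differentiableOn (by norm_num)

/-- The radius δ' is left free so that segments stay in whichever smaller ball the other estimates
impose. -/
theorem exists_convex (hF : IsFold K G β φ v p₀) :
    ∃ δ > 0, ∀ p ∈ K ∩ Metric.ball p₀ δ, ∀ q ∈ K ∩ Metric.ball p₀ δ,
      ∀ δ' > 0, p ∈ Metric.ball p₀ δ' → q ∈ Metric.ball p₀ δ' →
      segment ℝ q p ⊆ K ∩ Metric.ball p₀ δ' := by
  obtain ⟨r, hr, hc⟩ := hF.locally_convex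
  refine ⟨r, hr, fun p hp q hq δ' _ hp' hq' => subset_inter ?_ ?_⟩
  · exact (hc.segment_subset hq hp).trans inter_subset_left
  · exact (convex_ball _ _).segment_subset hq' hp'

/-- Differences of zeros near a fold point are almost parallel to the kernel. -/
theorem exists_direction (hF : IsFold K G β φ v p₀) {ε : ℝ} (hε : 0 < ε) :
    ∃ δ > 0, ∀ p ∈ K ∩ Metric.ball p₀ δ, ∀ q ∈ K ∩ Metric.ball p₀ δ, G p = 0 → G q = 0 →
      p ≠ q → φ (p.2 - q.2) ≠ 0 ∧
        ‖(φ (p.2 - q.2))⁻¹ • (p - q) - ((0 : ℝ), v)‖ < ε := by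
  obtain ⟨C, hC, hlow⟩ := hF.lower
  obtain ⟨r, hr, hconv⟩ := hF.locally_convex
  -- The first bound gives C κ ≤ 1/2, which lets ‖w‖ be absorbed below; the second makes what
  -- remains at most ε/4 · |s|.
  set κ : ℝ := min (1 / (2 * C)) (ε / (4 * C * (‖v‖ + 1))) with hκ
  have hv : 0 ≤ ‖v‖ := norm_nonneg v
  have hκ0 : 0 < κ := lt_min (by positivity) (by positivity)
  obtain ⟨δ, hδ, hst⟩ := exists_ball_norm_sub_fderivWithin_le hr hconv hF.uniqueDiffOn hF.mem
    (hF.contDiffOn.of_le (by norm_num)) hκ0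
  refine ⟨δ, hδ, fun p hp q hq hGp hGq hne => ?_⟩
  have h1 := hst p hp q hq
  rw [hGp, hGq, sub_zero, zero_sub, norm_neg] at h1
  set s := φ (p.2 - q.2) with hs
  -- The part of p - q transversal to the kernel: it has the same image under the differential and φ
  -- vanishes on it, so `lower` bounds it by the small linearization error.
  set w : ℝ × X := (p - q) - s • ((0 : ℝ), v) with hw
  have hDw : fderivWithin ℝ G K p₀ w = fderivWithin ℝ G K p₀ (p - q) := by
    rw [hw, map_sub, map_smul, hF.kernel, smul_zero, sub_zero]
  have hφw : φ w.2 = 0 := by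
    simp [hw, hF.normalized, hs]
  have h2 := hlow w
  rw [hDw, hφw, abs_zero, add_zero] at h2
  have h3 : ‖p - q‖ ≤ ‖w‖ + |s| * ‖v‖ := by
    have : p - q = w + s • ((0 : ℝ), v) := by rw [hw]; abel
    have hv0 : ‖((0 : ℝ), v)‖ = ‖v‖ := by rw [Prod.norm_mk, norm_zero, max_eq_right hv]
    calc ‖p - q‖ = ‖w + s • ((0 : ℝ), v)‖ := by rw [← this]
      _ ≤ ‖w‖ + ‖s • ((0 : ℝ), v)‖ := norm_add_le _ _
      _ = ‖w‖ + |s| * ‖v‖ := by rw [norm_smul, hv0, Real.norm_eq_abs]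
  have hκ1 : C * κ ≤ 1 / 2 := by
    have : κ ≤ 1 / (2 * C) := min_le_left _ _
    calc C * κ ≤ C * (1 / (2 * C)) := by gcongr
      _ = 1 / 2 := by field_simp
  have hκ2 : C * κ * (‖v‖ + 1) ≤ ε / 4 := by
    have : κ ≤ ε / (4 * C * (‖v‖ + 1)) := min_le_right _ _
    calc C * κ * (‖v‖ + 1) ≤ C * (ε / (4 * C * (‖v‖ + 1))) * (‖v‖ + 1) := by gcongr
      _ = ε / 4 := by field_simp
  have h4 : ‖w‖ ≤ C * κ * ‖p - q‖ := by
    calc ‖w‖ ≤ C * ‖fderivWithin ℝ G K p₀ (p - q)‖ := h2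
      _ ≤ C * (κ * ‖p - q‖) := by gcongr
      _ = _ := by ring
  have hCκ : 0 < C * κ := by positivity
  have h5 : ‖w‖ ≤ ε / 2 * |s| := by
    have e1 : C * κ * ‖p - q‖ ≤ C * κ * (‖w‖ + |s| * ‖v‖) := by gcongr
    have e2 : C * κ * ‖w‖ ≤ 1 / 2 * ‖w‖ := by gcongr
    have e3 : C * κ * ‖v‖ * |s| ≤ ε / 4 * |s| := by
      gcongr
      exact le_trans (by gcongr; linarith) hκ2
    nlinarith
  have hs0 : s ≠ 0 := by
    intro h0
    rw [h0, abs_zero, mul_zero] at h5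
    have : w = 0 := norm_le_zero_iff.1 h5
    rw [hw, h0, zero_smul, sub_zero, sub_eq_zero] at this
    exact hne this
  refine ⟨hs0, ?_⟩
  have hw' : s⁻¹ • (p - q) - ((0 : ℝ), v) = s⁻¹ • w := by
    rw [hw, smul_sub _ (p - q), smul_smul, inv_mul_cancel₀ hs0, one_smul]
  rw [hw', norm_smul, norm_inv, Real.norm_eq_abs]
  have hsp : 0 < |s| := abs_pos.2 hs0
  calc |s|⁻¹ * ‖w‖ ≤ |s|⁻¹ * (ε / 2 * |s|) := by gcongr
    _ = ε / 2 := by field_simp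
    _ < ε := by linarith

/-- Sign of the increment of the differential near a fold point in the kernel direction. -/
theorem exists_increment (hF : IsFold K G β φ v p₀) :
    ∃ ε > 0, ∃ δ > 0, ∀ q ∈ K ∩ Metric.ball p₀ δ, ∀ (σ : ℝ) (w w' : ℝ × X), σ ≠ 0 →
      q - p₀ = σ • w → ‖w - (0, v)‖ < ε → ‖w' - (0, v)‖ < ε →
      0 < σ * (β v (fderivWithin ℝ G K q w') - β v (fderivWithin ℝ G K p₀ w')) := by
  set D2 := fderivWithin ℝ (fderivWithin ℝ G K) K p₀ with hD2
  set b := β v (D2 (0, v) (0, v)) with hb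
  have hb0 : 0 < b := hF.second
  obtain ⟨r, hr, hconv⟩ := hF.locally_convex
  have hcont : ContinuousAt (fun z : (ℝ × X) × (ℝ × X) => β v (D2 z.1 z.2))
      (((0 : ℝ), v), ((0 : ℝ), v)) := by fun_prop
  obtain ⟨ε₁, hε₁, hc⟩ := Metric.continuousAt_iff.1 hcont (b / 2) (by positivity)
  set M : ℝ := ‖v‖ + 1 with hM
  have hM0 : 0 < M := by positivity
  set κ : ℝ := b / (4 * (‖β v‖ + 1) * M ^ 2) with hκ
  -- The second-order term contributes at least b/2 · σ²; κ keeps the remainder below b/4 · σ².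
  have hκ0 : 0 < κ := by positivity
  obtain ⟨δ, hδ, hst⟩ := exists_ball_norm_sub_fderivWithin_le hr hconv hF.uniqueDiffOn hF.mem
    hF.contDiffOn_fderivWithin hκ0
  refine ⟨min ε₁ 1, lt_min hε₁ one_pos, δ, hδ, fun q hq σ w w' hσ hqw hw hw' => ?_⟩
  have hnorm : ∀ z : ℝ × X, ‖z - (0, v)‖ < min ε₁ 1 → ‖z‖ ≤ M := fun z hz => by
    have h1 : ‖z‖ ≤ ‖z - (0, v)‖ + ‖((0 : ℝ), v)‖ := by
      have := norm_add_le (z - (0, v)) ((0 : ℝ), v)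
      rwa [sub_add_cancel] at this
    have h2 : ‖((0 : ℝ), v)‖ = ‖v‖ := by
      rw [Prod.norm_mk, norm_zero, max_eq_right (norm_nonneg v)]
    have h3 := lt_of_lt_of_le hz (min_le_right _ _)
    rw [h2] at h1; rw [hM]; linarith
  have h1 := hst q hq p₀ ⟨hF.mem, Metric.mem_ball_self hδ⟩
  rw [hqw, map_smul, norm_smul, Real.norm_eq_abs, ← hD2] at h1
  have h2 : b / 2 < β v (D2 w w') := by
    have := @hc (w, w') (by
      rw [Prod.dist_eq, dist_eq_norm, dist_eq_norm]
      exact max_lt (lt_of_lt_of_le hw (min_le_left _ _)) (lt_of_lt_of_le hw' (min_le_left _ _)))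
    rw [Real.dist_eq, abs_lt] at this
    simp only [← hb] at this
    linarith [this.1]
  set R := fderivWithin ℝ G K q - fderivWithin ℝ G K p₀ - σ • D2 w with hR
  have h3 : |β v (R w')| ≤ b / 4 * |σ| := by
    have hβ : 0 ≤ ‖β v‖ := norm_nonneg _
    calc |β v (R w')| ≤ ‖β v‖ * (‖R‖ * ‖w'‖) :=
          ((β v).le_opNorm _).trans (by gcongr; exact R.le_opNorm _)
      _ ≤ (‖β v‖ + 1) * ((κ * (|σ| * M)) * M) := by
          gcongr
          · linarith
          · exact h1.trans (by gcongr; exact hnorm w hw)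
          · exact hnorm w' hw'
      _ = b / 4 * |σ| := by rw [hκ]; field_simp
  have h4 : β v (fderivWithin ℝ G K q w') - β v (fderivWithin ℝ G K p₀ w')
      = σ * β v (D2 w w') + β v (R w') := by
    simp [hR]
  rw [h4]
  have hs : 0 < |σ| := abs_pos.2 hσ
  have h5 : -(b / 4 * |σ| * |σ|) ≤ σ * β v (R w') := by
    have : |σ * β v (R w')| ≤ b / 4 * |σ| * |σ| := by
      rw [abs_mul]; nlinarith
    exact (abs_le.1 this).1
  have h6 : |σ| * |σ| = σ * σ := abs_mul_abs_self σ
  have h7 : 0 < σ * σ := by rw [← h6]; positivity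
  nlinarith

/-- Convexity of the pairing along segments in the kernel direction. -/
theorem exists_convexity (hF : IsFold K G β φ v p₀) :
    ∃ ε > 0, ∃ δ > 0, ∀ q ∈ K ∩ Metric.ball p₀ δ, ∀ q' ∈ K ∩ Metric.ball p₀ δ,
      ∀ (σ : ℝ) (k : X), 0 < σ → q - q' = σ • (0, k) → ‖k - v‖ < ε →
      β k (fderivWithin ℝ G K q' (0, k)) < β k (fderivWithin ℝ G K q (0, k)) := by
  set D2 := fderivWithin ℝ (fderivWithin ℝ G K) K p₀ with hD2
  set b := β v (D2 (0, v) (0, v)) with hb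
  have hb0 : 0 < b := hF.second
  obtain ⟨r, hr, hconv⟩ := hF.locally_convex
  have hcont : ContinuousAt (fun k : X => β k (D2 ((0 : ℝ), k) ((0 : ℝ), k))) v := by fun_prop
  obtain ⟨ε₁, hε₁, hc⟩ := Metric.continuousAt_iff.1 hcont (b / 2) (by positivity)
  set M : ℝ := ‖v‖ + 1 with hM
  have hM0 : 0 < M := by positivity
  -- Here the pairing is taken with the moving vector k instead of v, because β k (G) is what
  -- represents the derivative of the functional along k; this costs a third factor M.
  set κ : ℝ := b / (4 * (‖β‖ + 1) * M ^ 3) with hκ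
  have hκ0 : 0 < κ := by positivity
  obtain ⟨δ, hδ, hst⟩ := exists_ball_norm_sub_fderivWithin_le hr hconv hF.uniqueDiffOn hF.mem
    hF.contDiffOn_fderivWithin hκ0
  refine ⟨min ε₁ 1, lt_min hε₁ one_pos, δ, hδ, fun q hq q' hq' σ k hσ hqk hk => ?_⟩
  have hkM : ‖k‖ ≤ M := by
    have h1 : ‖k‖ ≤ ‖k - v‖ + ‖v‖ := by simpa using norm_add_le (k - v) v
    have h3 := lt_of_lt_of_le hk (min_le_right _ _)
    rw [hM]; linarith
  have hn : ‖((0 : ℝ), k)‖ = ‖k‖ := by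
    rw [Prod.norm_mk, norm_zero, max_eq_right (norm_nonneg k)]
  have h1 := hst q hq q' hq'
  rw [hqk, map_smul, norm_smul, Real.norm_eq_abs, ← hD2, abs_of_pos hσ, hn] at h1
  have h2 : b / 2 < β k (D2 (0, k) (0, k)) := by
    have := @hc k (by
      rw [dist_eq_norm]
      exact lt_of_lt_of_le hk (min_le_left _ _))
    rw [Real.dist_eq, abs_lt] at this
    simp only [← hb] at this
    linarith [this.1]
  set R := fderivWithin ℝ G K q - fderivWithin ℝ G K q' - σ • D2 (0, k) with hR
  have h3 : |β k (R (0, k))| ≤ b / 4 * σ := by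
    have hβ : 0 ≤ ‖β‖ := ContinuousLinearMap.opNorm_nonneg β
    calc |β k (R (0, k))| ≤ (‖β‖ * ‖k‖) * (‖R‖ * ‖k‖) := by
          refine ((β k).le_opNorm _).trans ?_
          gcongr
          · exact β.le_opNorm k
          · rw [← hn]; exact R.le_opNorm _
      _ ≤ ((‖β‖ + 1) * M) * ((κ * (σ * M)) * M) := by
          gcongr
          · linarith
          · exact h1.trans (by gcongr)
      _ = b / 4 * σ := by rw [hκ]; field_simp
  have h4 : β k (fderivWithin ℝ G K q (0, k)) - β k (fderivWithin ℝ G K q' (0, k))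
      = σ * β k (D2 (0, k) (0, k)) + β k (R (0, k)) := by
    simp [hR]
  have h5 := (abs_le.1 h3).1
  nlinarith

/-- Structure of the zero set near a fold point: it lies on one side in time, it has at most one
point at each time on each side of the kernel of `φ`, and any functional whose differential is
represented by `G` is ordered along it. -/
theorem exists_structure (hF : IsFold K G β φ v p₀) :
    ∃ δ > 0,
      (∀ p ∈ K ∩ Metric.ball p₀ δ, G p = 0 → p ≠ p₀ → φ (p.2 - p₀.2) ≠ 0 ∧
        (p.1 - p₀.1) * β v (fderivWithin ℝ G K p₀ (1, 0)) < 0) ∧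
      (∀ p ∈ K ∩ Metric.ball p₀ δ, ∀ q ∈ K ∩ Metric.ball p₀ δ, p.1 = q.1 → G p = 0 → G q = 0 →
        p ≠ q → φ (p.2 - p₀.2) * φ (q.2 - p₀.2) < 0) ∧
      (∀ p ∈ K ∩ Metric.ball p₀ δ, ∀ q ∈ K ∩ Metric.ball p₀ δ, p.1 = q.1 → G p = 0 → G q = 0 →
        0 < φ (p.2 - q.2) → ∀ F : X → ℝ,
        (∀ x, (p.1, x) ∈ K → HasFDerivAt F ((β.flip (G (p.1, x)))) x) → F p.2 < F q.2) := by
  obtain ⟨ε₁, hε₁, δ₁, hδ₁, hinc⟩ := hF.exists_increment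
  obtain ⟨ε₂, hε₂, δ₂, hδ₂, hcvx⟩ := hF.exists_convexity
  obtain ⟨δ₃, hδ₃, hdir⟩ := hF.exists_direction (lt_min hε₁ hε₂)
  obtain ⟨δ₄, hδ₄, hseg⟩ := hF.exists_convex
  set δ := min (min δ₁ δ₂) (min δ₃ δ₄) with hδ
  have hδ0 : 0 < δ := lt_min (lt_min hδ₁ hδ₂) (lt_min hδ₃ hδ₄)
  have s1 : K ∩ Metric.ball p₀ δ ⊆ K ∩ Metric.ball p₀ δ₁ := inter_subset_inter_right _
    (Metric.ball_subset_ball ((min_le_left _ _).trans (min_le_left _ _)))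
  have s2 : K ∩ Metric.ball p₀ δ ⊆ K ∩ Metric.ball p₀ δ₂ := inter_subset_inter_right _
    (Metric.ball_subset_ball ((min_le_left _ _).trans (min_le_right _ _)))
  have s3 : K ∩ Metric.ball p₀ δ ⊆ K ∩ Metric.ball p₀ δ₃ := inter_subset_inter_right _
    (Metric.ball_subset_ball ((min_le_right _ _).trans (min_le_left _ _)))
  have s4 : K ∩ Metric.ball p₀ δ ⊆ K ∩ Metric.ball p₀ δ₄ := inter_subset_inter_right _
    (Metric.ball_subset_ball ((min_le_right _ _).trans (min_le_right _ _)))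
  have hsub : ∀ p ∈ K ∩ Metric.ball p₀ δ, ∀ q ∈ K ∩ Metric.ball p₀ δ,
      segment ℝ q p ⊆ K ∩ Metric.ball p₀ δ := fun p hp q hq =>
    hseg p (s4 hp) q (s4 hq) δ hδ0 hp.2 hq.2
  have hp₀ : p₀ ∈ K ∩ Metric.ball p₀ δ := ⟨hF.mem, Metric.mem_ball_self hδ0⟩
  have hmem : ∀ p ∈ K ∩ Metric.ball p₀ δ, ∀ q ∈ K ∩ Metric.ball p₀ δ, ∀ r ∈ Icc (0 : ℝ) 1,
      q + r • (p - q) ∈ K ∩ Metric.ball p₀ δ := fun p hp q hq r hr =>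
    hsub p hp q hq (by rw [segment_eq_image']; exact ⟨r, hr, rfl⟩)
  -- Since β v annihilates the range of the spatial differential, only the time component survives
  -- at p₀.
  have hD : ∀ p : ℝ × X, β v (fderivWithin ℝ G K p₀ p)
      = p.1 * β v (fderivWithin ℝ G K p₀ (1, 0)) := fun p => by
    have : p = p.1 • ((1 : ℝ), (0 : X)) + (0, p.2) := by ext <;> simp
    conv_lhs => rw [this, map_add, map_smul, map_add, map_smul, hF.range, add_zero, smul_eq_mul]
  have key : ∀ p ∈ K ∩ Metric.ball p₀ δ, G p = 0 → p ≠ p₀ → φ (p.2 - p₀.2) ≠ 0 ∧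
      (p.1 - p₀.1) * β v (fderivWithin ℝ G K p₀ (1, 0)) < 0 := by
    intro p hp hGp hne
    obtain ⟨hs, hw⟩ := hdir p (s3 hp) p₀ (s3 hp₀) hGp hF.zero hne
    refine ⟨hs, ?_⟩
    -- Rolle gives a point p₀ + r (p - p₀) where β v (DG (p - p₀)) = 0. Comparison with its value at
    -- p₀ by `exists_increment` fixes the sign of (p.1 - p₀.1) times the time derivative.
    obtain ⟨r, hr, h0⟩ := exists_fderivWithin_segment_eq_zero (β v)
      ((hsub p hp p₀ hp₀).trans inter_subset_left) hF.differentiableOn (by rw [hGp, hF.zero])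
    set s := φ (p.2 - p₀.2) with hsdef
    have hq := hmem p hp p₀ hp₀ r (Ioo_subset_Icc_self hr)
    have hw1 := lt_of_lt_of_le hw (min_le_left _ _)
    have := hinc _ (s1 hq) (r * s) (s⁻¹ • (p - p₀)) (s⁻¹ • (p - p₀))
      (mul_ne_zero hr.1.ne' hs)
      (by rw [smul_smul, mul_assoc, mul_inv_cancel₀ hs, mul_one]; abel) hw1 hw1
    rw [map_smul, map_smul, map_smul, map_smul, h0, hD (p - p₀), smul_zero, zero_sub,
      smul_eq_mul, Prod.fst_sub] at this
    have h2 : r * s * -(s⁻¹ * ((p.1 - p₀.1) * β v (fderivWithin ℝ G K p₀ (1, 0))))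
        = r * -((p.1 - p₀.1) * β v (fderivWithin ℝ G K p₀ (1, 0))) := by field_simp
    rw [h2] at this
    have := pos_of_mul_pos_right this hr.1.le
    linarith
  refine ⟨δ, hδ0, key, ?_, ?_⟩
  · intro p hp q hq hpq hGp hGq hne
    have hpne : p ≠ p₀ := by
      rintro rfl
      have := (key q hq hGq hne.symm).2
      rw [hpq, sub_self, zero_mul] at this
      exact lt_irrefl _ this
    have hqne : q ≠ p₀ := by
      rintro rfl
      have := (key p hp hGp hne).2
      rw [hpq, sub_self, zero_mul] at this
      exact lt_irrefl _ this
    obtain ⟨hs1, hw1⟩ := hdir p (s3 hp) p₀ (s3 hp₀) hGp hF.zero hpne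
    obtain ⟨hs2, hw2⟩ := hdir q (s3 hq) p₀ (s3 hp₀) hGq hF.zero hqne
    obtain ⟨hs, hw⟩ := hdir p (s3 hp) q (s3 hq) hGp hGq hne
    by_contra hcon
    -- Suppose both zeros lie on the same side. The Rolle point on the segment between them is then
    -- still seen from p₀ in a direction close to v. But β v (DG (p - q)) vanishes both there and at
    -- p₀, as p - q has no time component, so the increment cannot be nonzero.
    have hpos : 0 < φ (p.2 - p₀.2) * φ (q.2 - p₀.2) :=
      lt_of_le_of_ne (not_lt.1 hcon) (mul_ne_zero hs1 hs2).symm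
    obtain ⟨r, hr, h0⟩ := exists_fderivWithin_segment_eq_zero (β v)
      ((hsub p hp q hq).trans inter_subset_left) hF.differentiableOn (by rw [hGp, hGq])
    set a := φ (p.2 - p₀.2) with ha
    set c := φ (q.2 - p₀.2) with hc
    set s := φ (p.2 - q.2) with hsdef
    set σ := r * a + (1 - r) * c with hσ
    have hr1 : 0 < 1 - r := by linarith [hr.2]
    have hσa : 0 < σ * a := by
      have : σ * a = r * a ^ 2 + (1 - r) * (a * c) := by rw [hσ]; ring
      rw [this]
      have := hr.1
      positivity
    have hσ0 : σ ≠ 0 := fun h => by rw [h, zero_mul] at hσa; exact lt_irrefl _ hσa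
    have hσc : 0 < σ * c := by
      have : σ * c = r * (a * c) + (1 - r) * c ^ 2 := by rw [hσ]; ring
      rw [this]
      have := hr.1
      positivity
    have hq' := hmem p hp q hq r (Ioo_subset_Icc_self hr)
    set w1 := a⁻¹ • (p - p₀) with hw1def
    set w2 := c⁻¹ • (q - p₀) with hw2def
    -- The weights are nonnegative because a, c and σ share their sign; they sum to 1, so convexity
    -- of the ball applies.
    have hcomb : ‖(r * a / σ) • w1 + ((1 - r) * c / σ) • w2 - ((0 : ℝ), v)‖ < ε₁ := by
      have hball : Convex ℝ (Metric.ball ((0 : ℝ), v) ε₁) := convex_ball _ _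
      have := hball (x := w1) (y := w2)
        (by rw [mem_ball_iff_norm]; exact lt_of_lt_of_le hw1 (min_le_left _ _))
        (by rw [mem_ball_iff_norm]; exact lt_of_lt_of_le hw2 (min_le_left _ _))
        (a := r * a / σ) (b := (1 - r) * c / σ)
        (by rw [mul_div_assoc]
            have : a / σ = (σ * a) / σ ^ 2 := by field_simp
            rw [this]; have := hr.1; positivity)
        (by rw [mul_div_assoc]
            have : c / σ = (σ * c) / σ ^ 2 := by field_simp
            rw [this]; positivity)
        (by rw [← add_div, ← hσ, div_self hσ0])
      rwa [mem_ball_iff_norm] at this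
    have hw1a : p - p₀ = a • w1 := by rw [hw1def, smul_smul, mul_inv_cancel₀ hs1, one_smul]
    have hw2c : q - p₀ = c • w2 := by rw [hw2def, smul_smul, mul_inv_cancel₀ hs2, one_smul]
    clear_value w1 w2
    have hsum : q + r • (p - q) - p₀ = σ • ((r * a / σ) • w1 + ((1 - r) * c / σ) • w2) :=
      calc q + r • (p - q) - p₀ = r • (p - p₀) + (1 - r) • (q - p₀) := by module
        _ = (σ * (r * a / σ)) • w1 + (σ * ((1 - r) * c / σ)) • w2 := by
          rw [hw1a, hw2c, smul_smul r, smul_smul (1 - r), mul_div_cancel₀ _ hσ0, mul_div_cancel₀ _ hσ0]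
        _ = _ := by rw [smul_add, mul_smul, mul_smul]
    have := hinc _ (s1 hq') σ _ (s⁻¹ • (p - q)) hσ0 hsum hcomb (lt_of_lt_of_le hw (min_le_left _ _))
    rw [map_smul, map_smul, map_smul, map_smul, h0, hD (p - q), Prod.fst_sub, hpq, sub_self,
      zero_mul, smul_zero, sub_zero, mul_zero] at this
    exact lt_irrefl _ this
  · intro p hp q hq hpq hGp hGq hs F hFd
    have hne : p ≠ q := by
      rintro rfl
      simp at hs
    obtain ⟨-, hw⟩ := hdir p (s3 hp) q (s3 hq) hGp hGq hne
    set s := φ (p.2 - q.2) with hsdef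
    set h := p.2 - q.2 with hh
    set k := s⁻¹ • h with hk
    have hsk : s • k = h := by rw [hk, smul_smul, mul_inv_cancel₀ hs.ne', one_smul]
    have hpq' : p - q = (0, h) := Prod.ext (by simp [hpq]) rfl
    have hkv : ‖k - v‖ < ε₂ := by
      have h1 : s⁻¹ • (p - q) - ((0 : ℝ), v) = (0, k - v) := by
        rw [hpq']; simp [hk]
      rw [h1, Prod.norm_mk, norm_zero, max_eq_right (norm_nonneg _)] at hw
      exact lt_of_lt_of_le hw (min_le_right _ _)
    have hs0k : s • ((0 : ℝ), k) = p - q := by rw [hpq', Prod.smul_mk, hsk, smul_zero]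
    clear_value k
    have hsegK : segment ℝ q p ⊆ K := (hsub p hp q hq).trans inter_subset_left
    have hpt : ∀ r : ℝ, q + r • (p - q) = (p.1, q.2 + r • h) := fun r => by
      rw [hpq']; ext <;> simp [hpq]
    have hline : ∀ r ∈ Icc (0 : ℝ) 1, HasDerivAt (fun r : ℝ => F (q.2 + r • h))
        (β h (G (q + r • (p - q)))) r := fun r hr => by
      have h1 : HasDerivAt (fun r : ℝ => q.2 + r • h) h r := by
        simpa using ((hasDerivAt_id r).smul_const h).const_add q.2
      have h2 := hFd (q.2 + r • h) (by rw [← hpt]; exact (hmem p hp q hq r hr).1)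
      rw [hpt, ← ContinuousLinearMap.flip_apply]
      exact h2.comp_hasDerivAt r h1
    obtain ⟨c, hc, hc'⟩ := exists_hasDerivAt_eq_slope (fun r : ℝ => F (q.2 + r • h))
      (fun r => β h (G (q + r • (p - q)))) zero_lt_one
      (fun r hr => (hline r hr).continuousAt.continuousWithinAt)
      (fun r hr => hline r (Ioo_subset_Icc_self hr))
    -- Along the segment the derivative of F vanishes at both ends, since p and q are zeros, and is
    -- itself strictly convex by `exists_convexity`. It is therefore negative inside, and F
    -- decreases from q to p.
    have hneg : β h (G (q + c • (p - q))) < 0 := by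
      refine neg_of_strictMono_deriv (g := fun r : ℝ => β h (G (q + r • (p - q))))
        (g' := fun r => β h (fderivWithin ℝ G K (q + r • (p - q)) (p - q)))
        ((β h).continuous.comp_continuousOn
          (continuousOn_comp_segment hsegK hF.differentiableOn.continuousOn))
        (fun r hr => (β h).hasFDerivAt.comp_hasDerivAt r
          (hasDerivAt_comp_segment hsegK hF.differentiableOn hr))
        (by simp [hGq]) (by simp [hGp]) ?_ hc
      intro r hr r' hr' hlt
      have := hcvx _ (s2 (hmem p hp q hq r (Ioo_subset_Icc_self hr))) _
        (s2 (hmem p hp q hq r' (Ioo_subset_Icc_self hr'))) ((r - r') * s) k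
        (mul_pos (by linarith) hs) (by
          rw [mul_smul, hs0k]; module) hkv
      have e : ∀ z, β h (fderivWithin ℝ G K z (p - q))
          = s ^ 2 * β k (fderivWithin ℝ G K z (0, k)) := fun z => by
        have hβ : β h = s • β k := by rw [← hsk, map_smul]
        rw [hβ, ← hs0k, map_smul, map_smul, smul_apply, smul_eq_mul, smul_eq_mul]
        ring
      simp only [e]
      gcongr
    rw [hc'] at hneg
    have h1 : q.2 + (1 : ℝ) • h = p.2 := by rw [hh]; module
    rw [h1] at hneg
    simp only [zero_smul, add_zero, sub_zero, div_one] at hneg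
    linarith

end IsFold

end Fold

/-! ### The duality between X and Y inherited from H -/

section Pairing

variable {H X Y : Type*} [NormedAddCommGroup H] [InnerProductSpace ℝ H]
  [NormedAddCommGroup X] [NormedSpace ℝ X] [NormedAddCommGroup Y] [NormedSpace ℝ Y]

/-- The pairing of `X` and `Y` induced by the inner product of `H`. -/
noncomputable def pairing (i : X →L[ℝ] H) (j : Y →L[ℝ] H) : X →L[ℝ] Y →L[ℝ] ℝ :=
  LinearMap.mkContinuous₂
    (LinearMap.mk₂ ℝ (fun (h : X) (y : Y) => (inner ℝ (j y) (i h) : ℝ))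
      (fun a b y => by rw [map_add, inner_add_right])
      (fun c a y => by rw [map_smul, real_inner_smul_right, smul_eq_mul])
      (fun a y z => by rw [map_add, inner_add_left])
      (fun c a y => by rw [map_smul, real_inner_smul_left, smul_eq_mul]))
    (‖j‖ * ‖i‖) (fun h y => by
      calc ‖(inner ℝ (j y) (i h) : ℝ)‖ ≤ ‖j y‖ * ‖i h‖ := norm_inner_le_norm _ _
        _ ≤ (‖j‖ * ‖y‖) * (‖i‖ * ‖h‖) := by
          gcongr
          · exact j.le_opNorm y
          · exact i.le_opNorm h
        _ = _ := by ring)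

end Pairing

/-! ### Derivatives of the energy expressed through its differential -/

section Setting

variable {H X Y : Type*} [NormedAddCommGroup H] [InnerProductSpace ℝ H]
  [NormedAddCommGroup X] [NormedSpace ℝ X] [NormedAddCommGroup Y] [NormedSpace ℝ Y]
  {T : ℝ} {D : Set H} {E : ℝ → H → ℝ} {i : X →L[ℝ] H} {j : Y →L[ℝ] H} {O : Set X}
  {f : ℝ → X → Y}

namespace IsSmoothSetting

theorem uniqueDiffOn (hS : IsSmoothSetting T D E i j O f) (hT : 0 < T) :
    UniqueDiffOn ℝ (Icc 0 T ×ˢ O) :=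
  (uniqueDiffOn_Icc hT).prod hS.isOpen.uniqueDiffOn

/-- Balls of the product norm are products of balls, so within a small ball around a point of O only
the convex time interval cuts. -/
theorem locally_convex (hS : IsSmoothSetting T D E i j O f) {p : ℝ × X}
    (hp : p ∈ Icc 0 T ×ˢ O) : ∃ r > 0, Convex ℝ ((Icc 0 T ×ˢ O) ∩ Metric.ball p r) := by
  obtain ⟨r, hr, hb⟩ := Metric.isOpen_iff.1 hS.isOpen p.2 hp.2
  refine ⟨r, hr, ?_⟩
  have : (Icc 0 T ×ˢ O) ∩ Metric.ball p r
      = (Icc 0 T ∩ Metric.ball p.1 r) ×ˢ Metric.ball p.2 r := by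
    ext ⟨t, x⟩
    rw [← ball_prod_same]
    simp only [mem_inter_iff, mem_prod]
    exact ⟨fun h => ⟨⟨h.1.1, h.2.1⟩, h.2.2⟩, fun h => ⟨⟨h.1.1, hb h.2⟩, h.1.2, h.2⟩⟩
  rw [this]
  exact ((convex_Icc _ _).inter (convex_ball _ _)).prod (convex_ball _ _)

/-- The joint differential of `f` in `(t, x)`. -/
theorem hasFDerivWithinAt (hS : IsSmoothSetting T D E i j O f) {p : ℝ × X}
    (hp : p ∈ Icc 0 T ×ˢ O) :
    HasFDerivWithinAt (fun p : ℝ × X => f p.1 p.2)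
      (fderivWithin ℝ (fun p : ℝ × X => f p.1 p.2) (Icc 0 T ×ˢ O) p) (Icc 0 T ×ˢ O) p :=
  (hS.differential_contDiff.differentiableOn (by norm_num) p hp).hasFDerivWithinAt

/-- Restricting a derivative within `[0,T] × O` to a time slice. -/
theorem hasFDerivAt_slice (hS : IsSmoothSetting T D E i j O f) {W : Type*}
    [NormedAddCommGroup W] [NormedSpace ℝ W] {G : ℝ × X → W} {L : ℝ × X →L[ℝ] W}
    {t : ℝ} (ht : t ∈ Icc 0 T) {x : X} (hx : x ∈ O)
    (hG : HasFDerivWithinAt G L (Icc 0 T ×ˢ O) (t, x)) :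
    HasFDerivAt (fun y => G (t, y)) (L.comp (ContinuousLinearMap.inr ℝ ℝ X)) x := by
  have h1 : HasFDerivWithinAt (fun y : X => (t, y)) (ContinuousLinearMap.inr ℝ ℝ X) O x :=
    (hasFDerivAt_prodMk_right t x).hasFDerivWithinAt
  exact (hG.comp x h1 fun y hy => ⟨ht, hy⟩).hasFDerivAt (hS.isOpen.mem_nhds hx)

theorem hasFDerivAt (hS : IsSmoothSetting T D E i j O f) {t : ℝ} (ht : t ∈ Icc 0 T) {x : X}
    (hx : x ∈ O) : HasFDerivAt (f t)
      ((fderivWithin ℝ (fun p : ℝ × X => f p.1 p.2) (Icc 0 T ×ˢ O) (t, x)).comp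
        (ContinuousLinearMap.inr ℝ ℝ X)) x :=
  hS.hasFDerivAt_slice ht hx (hS.hasFDerivWithinAt (p := (t, x)) ⟨ht, hx⟩)

theorem fderiv_apply (hS : IsSmoothSetting T D E i j O f) {t : ℝ} (ht : t ∈ Icc 0 T) {x : X}
    (hx : x ∈ O) (h : X) : fderiv ℝ (f t) x h
      = fderivWithin ℝ (fun p : ℝ × X => f p.1 p.2) (Icc 0 T ×ˢ O) (t, x) (0, h) := by
  rw [(hS.hasFDerivAt ht hx).fderiv]; rfl

theorem derivWithin_eq (hS : IsSmoothSetting T D E i j O f) (hT : 0 < T) {t : ℝ}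
    (ht : t ∈ Icc 0 T) {x : X} (hx : x ∈ O) : derivWithin (fun s => f s x) (Icc 0 T) t
      = fderivWithin ℝ (fun p : ℝ × X => f p.1 p.2) (Icc 0 T ×ˢ O) (t, x) (1, 0) := by
  have h1 : HasDerivWithinAt (fun s : ℝ => (s, x)) ((1 : ℝ), (0 : X)) (Icc 0 T) t :=
    ((hasDerivAt_id t).prodMk (hasDerivAt_const t x)).hasDerivWithinAt
  have hm : MapsTo (fun s : ℝ => (s, x)) (Icc 0 T) (Icc 0 T ×ˢ O) := fun s hs => ⟨hs, hx⟩
  have h2 := (hS.hasFDerivWithinAt (p := (t, x)) ⟨ht, hx⟩).comp_hasDerivWithinAt t h1 hm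
  exact h2.derivWithin (uniqueDiffOn_Icc hT t ht)

theorem energy_contDiffAt (hS : IsSmoothSetting T D E i j O f) {t : ℝ} (ht : t ∈ Icc 0 T) {x : X}
    (hx : x ∈ O) : ContDiffAt ℝ 3 (fun w => E t (i w)) x := by
  have h1 : ContDiffOn ℝ 3 (fun y : X => (t, y)) O := (contDiff_prodMk_right t).contDiffOn
  exact (hS.energy_contDiff.comp h1 fun y hy => ⟨ht, hy⟩).contDiffAt (hS.isOpen.mem_nhds hx)

theorem energy_fderiv (hS : IsSmoothSetting T D E i j O f) {t : ℝ} (ht : t ∈ Icc 0 T) {x : X}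
    (hx : x ∈ O) : fderiv ℝ (fun w => E t (i w)) x = (pairing i j).flip (f t x) := by
  ext h
  exact hS.differential_eq t ht x hx h

theorem energy_hasFDerivAt (hS : IsSmoothSetting T D E i j O f) {t : ℝ} (ht : t ∈ Icc 0 T) {x : X}
    (hx : x ∈ O) : HasFDerivAt (fun w => E t (i w)) ((pairing i j).flip (f t x)) x := by
  rw [← hS.energy_fderiv ht hx]
  exact ((hS.energy_contDiffAt ht hx).differentiableAt (by norm_num)).hasFDerivAt

theorem energy_fderiv_fderiv (hS : IsSmoothSetting T D E i j O f) {t : ℝ} (ht : t ∈ Icc 0 T)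
    {x : X} (hx : x ∈ O) (h k : X) :
    fderiv ℝ (fderiv ℝ (fun w => E t (i w))) x h k = pairing i j k (fderiv ℝ (f t) x h) := by
  have h1 : fderiv ℝ (fun w => E t (i w)) =ᶠ[𝓝 x] fun y => (pairing i j).flip (f t y) := by
    filter_upwards [hS.isOpen.mem_nhds hx] with y hy using hS.energy_fderiv ht hy
  rw [h1.fderiv_eq]
  have h2 : HasFDerivAt (fun y => (pairing i j).flip (f t y)) _ x :=
    (pairing i j).flip.hasFDerivAt.comp x
      ((hS.hasFDerivAt ht hx).differentiableAt.hasFDerivAt)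
  rw [h2.fderiv]
  rfl

/-- Schwarz's theorem for the energy. It makes the range of the Hessian orthogonal to its kernel,
which is how the range is identified at a fold. -/
theorem pairing_symm (hS : IsSmoothSetting T D E i j O f) {t : ℝ} (ht : t ∈ Icc 0 T)
    {x : X} (hx : x ∈ O) (h k : X) :
    pairing i j k (fderiv ℝ (f t) x h) = pairing i j h (fderiv ℝ (f t) x k) := by
  rw [← hS.energy_fderiv_fderiv ht hx, ← hS.energy_fderiv_fderiv ht hx]
  have := ((hS.energy_contDiffAt ht hx).of_le (m := 2) (by norm_num)).isSymmSndFDerivAt (by simp)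
  exact this h k

/-- Transfers (T.3) to the joint map in (t, x): both sides differentiate the same function, the
Hessian of the energy evaluated twice on v, at x in the direction v. -/
theorem energy_third (hS : IsSmoothSetting T D E i j O f) (hT : 0 < T) {t : ℝ}
    (ht : t ∈ Icc 0 T) {x : X} (hx : x ∈ O) (v : X) :
    iteratedFDeriv ℝ 3 (fun w => E t (i w)) x (fun _ => v)
      = pairing i j v (fderivWithin ℝ (fderivWithin ℝ (fun p : ℝ × X => f p.1 p.2) (Icc 0 T ×ˢ O))
        (Icc 0 T ×ˢ O) (t, x) (0, v) (0, v)) := by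
  set g := fun w => E t (i w) with hg
  have h1 : HasFDerivAt (fun y => iteratedFDeriv ℝ 2 g y (fun _ => v))
      ((ContinuousMultilinearMap.apply ℝ (fun _ : Fin 2 => X) ℝ (fun _ => v)).comp
        (fderiv ℝ (iteratedFDeriv ℝ 2 g) x)) x :=
    (ContinuousMultilinearMap.apply ℝ (fun _ : Fin 2 => X) ℝ (fun _ => v)).hasFDerivAt.comp x
      ((hS.energy_contDiffAt ht hx).differentiableAt_iteratedFDeriv (by norm_num)).hasFDerivAt
  set G := fun p : ℝ × X => f p.1 p.2 with hG
  have hD : HasFDerivWithinAt (fderivWithin ℝ G (Icc 0 T ×ˢ O)) _ (Icc 0 T ×ˢ O) (t, x) :=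
    ((hS.differential_contDiff.fderivWithin (m := 1) (hS.uniqueDiffOn hT)
      (by norm_num)).differentiableOn (by norm_num) (t, x) ⟨ht, hx⟩).hasFDerivWithinAt
  have h2 := hS.hasFDerivAt_slice ht hx hD
  have h3 := ((pairing i j v).comp
    (ContinuousLinearMap.apply ℝ Y ((0 : ℝ), v))).hasFDerivAt.comp x h2
  have h4 : (fun y => iteratedFDeriv ℝ 2 g y (fun _ => v)) =ᶠ[𝓝 x]
      (((pairing i j v).comp (ContinuousLinearMap.apply ℝ Y ((0 : ℝ), v))) ∘
        fun y => fderivWithin ℝ G (Icc 0 T ×ˢ O) (t, y)) := by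
    filter_upwards [hS.isOpen.mem_nhds hx] with y hy
    rw [iteratedFDeriv_two_apply, hS.energy_fderiv_fderiv ht hy, hS.fderiv_apply ht hy]
    rfl
  have h5 := h1.unique (h3.congr_of_eventuallyEq h4)
  rw [iteratedFDeriv_succ_apply_left]
  exact congrArg (fun L : X →L[ℝ] ℝ => L v) h5

theorem mem_of_crit (hS : IsSmoothSetting T D E i j O f) {t : ℝ} (ht : t ∈ Icc 0 T) {w : H}
    (hw : w ∈ crit D E t) : ∃ x ∈ O, i x = w :=
  (hS.critical_regular t ht w hw.1 hw.2).1

theorem mem_O_of_crit (hS : IsSmoothSetting T D E i j O f) {t : ℝ} (ht : t ∈ Icc 0 T) {x : X}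
    (hx : i x ∈ crit D E t) : x ∈ O := by
  obtain ⟨y, hy, hyx⟩ := hS.mem_of_crit ht hx
  rwa [← hS.i_injective hyx]

/-- Critical points are zeros of the differential. -/
theorem eq_zero_of_crit (hS : IsSmoothSetting T D E i j O f) {t : ℝ} (ht : t ∈ Icc 0 T) {x : X}
    (hc : i x ∈ crit D E t) : f t x = 0 := by
  have hx := hS.mem_O_of_crit ht hc
  -- The subdifferential inequality along x + r h, r ↓ 0, bounds the directional derivative below by
  -- -ε ‖i h‖; the chosen ε makes this incompatible with a negative derivative.
  have hnn : ∀ h : X, 0 ≤ pairing i j h (f t x) := by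
    intro h
    by_contra! hneg
    set ε : ℝ := -pairing i j h (f t x) / (2 * (‖i h‖ + 1)) with hε
    have hε0 : 0 < ε := by have := norm_nonneg (i h); exact div_pos (by linarith) (by positivity)
    have hline : HasDerivAt (fun r : ℝ => x + r • h) h 0 := by
      simpa using ((hasDerivAt_id (0 : ℝ)).smul_const h).const_add x
    have hd : HasDerivAt (fun r : ℝ => E t (i (x + r • h))) (pairing i j h (f t x)) 0 := by
      have h1 := hS.energy_hasFDerivAt ht hx
      have h2 : HasFDerivAt (fun w => E t (i w)) ((pairing i j).flip (f t x)) (x + (0 : ℝ) • h) := by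
        simpa using h1
      exact h2.comp_hasDerivAt 0 hline
    have hcx : Tendsto (fun r : ℝ => x + r • h) (𝓝[>] 0) (𝓝 x) := by
      have := hline.continuousAt.tendsto
      simp only [zero_smul, add_zero] at this
      exact this.mono_left nhdsWithin_le_nhds
    have hO : ∀ᶠ r : ℝ in 𝓝[>] 0, x + r • h ∈ O := hcx (hS.isOpen.mem_nhds hx)
    have hci : Tendsto (fun r : ℝ => i (x + r • h)) (𝓝[>] 0) (𝓝[D] (i x)) :=
      tendsto_nhdsWithin_iff.2 ⟨(i.continuous.tendsto x).comp hcx,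
        hO.mono fun r hr => hS.subset_domain hr⟩
    have hev := hci.eventually (hc.2.2 ε hε0)
    have hsl := hd.tendsto_slope_zero_right
    have hge : -(ε * ‖i h‖) ≤ pairing i j h (f t x) := by
      refine ge_of_tendsto hsl ?_
      filter_upwards [hev, self_mem_nhdsWithin] with r hr hr0
      have hr0 : (0 : ℝ) < r := hr0
      simp only [map_add, map_smul, add_sub_cancel_left, inner_zero_left, norm_smul,
        Real.norm_eq_abs, abs_of_pos hr0, zero_sub] at hr
      simp only [zero_add, zero_smul, add_zero, smul_eq_mul, map_add, map_smul]
      rw [inv_mul_eq_div, le_div_iff₀ hr0]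
      nlinarith
    have h3 : ε * (2 * (‖i h‖ + 1)) = -pairing i j h (f t x) := by
      rw [hε]; have := norm_nonneg (i h); field_simp
    nlinarith [norm_nonneg (i h)]
  have hz : ∀ h : X, pairing i j h (f t x) = 0 := fun h => by
    have h1 := hnn h
    have h2 := hnn (-h)
    rw [map_neg, neg_apply] at h2
    linarith
  -- Orthogonality to the dense range of i is orthogonality to all of H.
  have hj : j (f t x) = 0 :=
    hS.i_dense.eq_zero_of_inner_left (𝕜 := ℝ) hz
  exact hS.j_injective (by rw [hj, map_zero])

end IsSmoothSetting

end Setting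

/-! ### Local structure of the critical set -/

section Setting

variable {H X Y : Type*} [NormedAddCommGroup H] [InnerProductSpace ℝ H]
  [NormedAddCommGroup X] [NormedSpace ℝ X] [NormedAddCommGroup Y] [NormedSpace ℝ Y]
  {T : ℝ} {D : Set H} {E : ℝ → H → ℝ} {i : X →L[ℝ] H} {j : Y →L[ℝ] H} {O : Set X}
  {f : ℝ → X → Y}

namespace IsSmoothSetting

/-- Near a nondegenerate critical point there is at most one critical point at each time. -/
theorem exists_unique_near (hS : IsSmoothSetting T D E i j O f) (hT : 0 < T) {t₀ : ℝ}
    (ht₀ : t₀ ∈ Icc 0 T) {x₀ : X} (hx₀ : x₀ ∈ O) (hinv : (fderiv ℝ (f t₀) x₀).IsInvertible) :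
    ∃ δ > 0, ∀ t x y, (t, x) ∈ Metric.ball (t₀, x₀) δ → (t, y) ∈ Metric.ball (t₀, x₀) δ →
      t ∈ Icc 0 T → x ∈ O → y ∈ O → f t x = 0 → f t y = 0 → x = y := by
  obtain ⟨A, hA⟩ := hinv
  set G := fun p : ℝ × X => f p.1 p.2 with hG
  have hp₀ : (t₀, x₀) ∈ Icc 0 T ×ˢ O := ⟨ht₀, hx₀⟩
  obtain ⟨r, hr, hconv⟩ := hS.locally_convex hp₀
  set M : ℝ := ‖(A.symm : Y →L[ℝ] X)‖ with hM
  have hM0 : 0 ≤ M := norm_nonneg _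
  -- M bounds the inverse, so this tolerance yields ‖x - y‖ ≤ ‖x - y‖ / 2 for two zeros at the same
  -- time.
  obtain ⟨δ, hδ, hst⟩ := exists_ball_norm_sub_fderivWithin_le hr hconv (hS.uniqueDiffOn hT) hp₀
    (hS.differential_contDiff.of_le (by norm_num)) (ε := 1 / (2 * (M + 1))) (by positivity)
  refine ⟨δ, hδ, fun t x y hx hy ht hxO hyO hfx hfy => ?_⟩
  have h1 := hst (t, x) ⟨⟨ht, hxO⟩, hx⟩ (t, y) ⟨⟨ht, hyO⟩, hy⟩
  have h2 : (t, x) - (t, y) = ((0 : ℝ), x - y) := by simp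
  rw [h2, ← hS.fderiv_apply ht₀ hx₀, ← hA] at h1
  simp only [hfx, hfy, sub_zero, zero_sub, norm_neg, Prod.norm_mk, norm_zero,
    max_eq_right (norm_nonneg _)] at h1
  have h3 : ‖x - y‖ ≤ M * ‖A (x - y)‖ := by
    have := (A.symm : Y →L[ℝ] X).le_opNorm (A (x - y))
    simpa using this
  have h4 : M * (1 / (2 * (M + 1))) ≤ 1 / 2 := by
    rw [mul_one_div, div_le_div_iff₀ (by positivity) (by norm_num)]; linarith
  have h5 : ‖x - y‖ ≤ 1 / 2 * ‖x - y‖ := by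
    calc ‖x - y‖ ≤ M * (1 / (2 * (M + 1)) * ‖x - y‖) := h3.trans (by gcongr; exact h1)
      _ = M * (1 / (2 * (M + 1))) * ‖x - y‖ := by ring
      _ ≤ _ := by gcongr
  have h6 : ‖x - y‖ ≤ 0 := by linarith
  exact sub_eq_zero.1 (norm_le_zero_iff.1 h6)

variable [CompleteSpace X] [CompleteSpace Y]

/-- The transversality conditions make degenerate critical points into folds. -/
theorem exists_isFold (hS : IsSmoothSetting T D E i j O f) (hT : 0 < T)
    (hTr : IsFullyTransversal T D E i j f) {t₀ : ℝ} (ht₀ : t₀ ∈ Icc 0 T) {x₀ : X}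
    (hdeg : IsDegenerate D E i f t₀ x₀) :
    ∃ (v : X) (φ : X →L[ℝ] ℝ),
      IsFold (Icc 0 T ×ˢ O) (fun p : ℝ × X => f p.1 p.2) (pairing i j) φ v (t₀, x₀) := by
  have hx₀ : x₀ ∈ O := hS.mem_O_of_crit ht₀ hdeg.1
  have hp₀ : (t₀, x₀) ∈ Icc 0 T ×ˢ O := ⟨ht₀, hx₀⟩
  set G := fun p : ℝ × X => f p.1 p.2 with hG
  set A := fderiv ℝ (f t₀) x₀ with hA
  set L := fderivWithin ℝ G (Icc 0 T ×ˢ O) (t₀, x₀) with hL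
  have hAL : ∀ h, A h = L (0, h) := hS.fderiv_apply ht₀ hx₀
  have hker := hTr.ker_dim t₀ ht₀ x₀ hdeg
  obtain ⟨⟨v₀, hv₀⟩, hv₀0, hspan₀⟩ := finrank_eq_one_iff'.1 hker
  have hv₀ne : v₀ ≠ 0 := fun h => hv₀0 (Subtype.ext h)
  have hthird := hTr.third_order t₀ ht₀ x₀ hdeg v₀ hv₀ hv₀ne
  rw [hS.energy_third hT ht₀ hx₀] at hthird
  -- The cubic form is odd, so replacing v₀ by -v₀ if needed makes it positive.
  obtain ⟨v, hv, hvne, hspan, hsec⟩ : ∃ v, A v = 0 ∧ v ≠ 0 ∧ (∀ h, A h = 0 → ∃ c : ℝ, c • v = h) ∧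
      0 < pairing i j v (fderivWithin ℝ (fderivWithin ℝ G (Icc 0 T ×ˢ O)) (Icc 0 T ×ˢ O)
        (t₀, x₀) (0, v) (0, v)) := by
    have hsp : ∀ h, A h = 0 → ∃ c : ℝ, c • v₀ = h := fun h hh => by
      obtain ⟨c, hc⟩ := hspan₀ ⟨h, hh⟩
      exact ⟨c, congrArg Subtype.val hc⟩
    rcases lt_or_gt_of_ne hthird with hlt | hgt
    · refine ⟨-v₀, by rw [map_neg, show A v₀ = 0 from hv₀, neg_zero], neg_ne_zero.2 hv₀ne,
        fun h hh => ?_, ?_⟩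
      · obtain ⟨c, hc⟩ := hsp h hh
        exact ⟨-c, by rw [neg_smul_neg, hc]⟩
      · have hneg : ((0 : ℝ), -v₀) = -((0 : ℝ), v₀) := by simp
        simp only [hneg, map_neg, neg_apply, neg_neg]
        linarith
    · exact ⟨v₀, hv₀, hv₀ne, hsp, hgt⟩
  obtain ⟨φ, hφ⟩ := SeparatingDual.exists_eq_one (R := ℝ) hvne
  have hrange : ∀ h, pairing i j v (A h) = 0 := fun h => by
    rw [hS.pairing_symm ht₀ hx₀, ← hA, hv, map_zero]
  have hα : pairing i j v (L (1, 0)) ≠ 0 := by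
    have := hTr.time_transversal t₀ ht₀ x₀ hdeg v hv hvne
    rwa [hS.derivWithin_eq hT ht₀ hx₀] at this
  refine ⟨v, φ, hp₀, hS.uniqueDiffOn hT, hS.locally_convex hp₀, hS.differential_contDiff,
    hS.eq_zero_of_crit ht₀ hdeg.1, hφ, by rw [← hL, ← hAL, hv], fun h => by
      rw [← hL, ← hAL, hrange], ?_, hsec⟩
  set a := L (1, 0) with ha
  have hLp : ∀ p : ℝ × X, L p = p.1 • a + A p.2 := fun p => by
    rw [hAL, ha, ← map_smul, ← map_add]; congr 1; ext <;> simp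
  -- Bordering the differential with φ gives a bijection. By index 0 the cokernel of A is
  -- one-dimensional. By (T.2) it is spanned by the class of a, because β v kills the range but not
  -- a. The bounded inverse provides `lower`.
  set M : ℝ × X →L[ℝ] Y × ℝ := L.prod (φ.comp (ContinuousLinearMap.snd ℝ ℝ X)) with hM
  have hMp : ∀ p, M p = (L p, φ p.2) := fun p => rfl
  have hMker : (M : ℝ × X →ₗ[ℝ] Y × ℝ).ker = ⊥ := by
    rw [LinearMap.ker_eq_bot']
    intro p hp
    have hp : M p = 0 := hp
    rw [hMp, hLp, Prod.mk_eq_zero] at hp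
    have h1 := congrArg (pairing i j v) hp.1
    rw [map_add, map_smul, hrange, add_zero, map_zero, smul_eq_mul] at h1
    have h2 : p.1 = 0 := (mul_eq_zero.1 h1).resolve_right hα
    have h3 : A p.2 = 0 := by simpa [h2] using hp.1
    obtain ⟨c, hc⟩ := hspan _ h3
    have h4 := hp.2
    rw [← hc, map_smul, hφ, smul_eq_mul, mul_one] at h4
    rw [h4, zero_smul] at hc
    exact Prod.ext h2 hc.symm
  have hcok : Module.finrank ℝ (Y ⧸ (A : X →ₗ[ℝ] Y).range) = 1 := by
    rw [← hS.index_zero t₀ ht₀ x₀ hx₀, hker]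
  have hna : (Submodule.Quotient.mk a : Y ⧸ (A : X →ₗ[ℝ] Y).range) ≠ 0 := by
    rw [Ne, Submodule.Quotient.mk_eq_zero]
    rintro ⟨h, hh⟩
    apply hα
    rw [← hh]
    exact hrange h
  have hMrange : (M : ℝ × X →ₗ[ℝ] Y × ℝ).range = ⊤ := by
    rw [LinearMap.range_eq_top]
    rintro ⟨y, c⟩
    obtain ⟨τ, hτ⟩ := (finrank_eq_one_iff_of_nonzero' _ hna).1 hcok (Submodule.Quotient.mk y)
    rw [← Submodule.Quotient.mk_smul, eq_comm, Submodule.Quotient.eq] at hτ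
    obtain ⟨h, hh⟩ := hτ
    have hh : A h = y - τ • a := hh
    refine ⟨(τ, h + (c - φ h) • v), ?_⟩
    change M _ = _
    rw [hMp, hLp]
    ext
    · simp [hh, hv]
    · simp [hφ]
  set e := ContinuousLinearEquiv.ofBijective M hMker hMrange with he
  refine ⟨‖(e.symm : Y × ℝ →L[ℝ] ℝ × X)‖ + 1, by positivity, fun p => ?_⟩
  have h1 := (e.symm : Y × ℝ →L[ℝ] ℝ × X).le_opNorm (e p)
  have h2 : e p = (L p, φ p.2) := by
    rw [he, ContinuousLinearEquiv.coeFn_ofBijective]; rfl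
  rw [ContinuousLinearEquiv.coe_coe, ContinuousLinearEquiv.symm_apply_apply, h2] at h1
  have h3 : ‖((L p, φ p.2) : Y × ℝ)‖ ≤ ‖L p‖ + |φ p.2| := by
    rw [Prod.norm_mk, Real.norm_eq_abs]
    exact max_le (by linarith [abs_nonneg (φ p.2)]) (by linarith [norm_nonneg (L p)])
  calc ‖p‖ ≤ _ := h1
    _ ≤ (‖(e.symm : Y × ℝ →L[ℝ] ℝ × X)‖ + 1) * (‖L p‖ + |φ p.2|) := by
      gcongr
      linarith

/-- Local structure of the critical set in `[0,T] × X` near one of its points. -/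
theorem exists_local_structure (hS : IsSmoothSetting T D E i j O f) (hT : 0 < T)
    (hTr : IsFullyTransversal T D E i j f) {t₀ : ℝ} (ht₀ : t₀ ∈ Icc 0 T) {x₀ : X}
    (hc₀ : i x₀ ∈ crit D E t₀) :
    ∃ N ∈ 𝓝 (t₀, x₀), ∃ s : X → ℝ, Continuous s ∧
      (∀ t x, (t, x) ∈ N → t ∈ Icc 0 T → i x ∈ crit D E t →
        (t = t₀ → x = x₀) ∧ (t ≠ t₀ → s x ≠ 0)) ∧
      (∀ t x y, (t, x) ∈ N → (t, y) ∈ N → t ∈ Icc 0 T → i x ∈ crit D E t → i y ∈ crit D E t →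
        E t (i x) < E t (i y) → s y < 0 ∧ 0 < s x) ∧
      (IsDegenerate D E i f t₀ x₀ → ∃ α : ℝ, ∀ t x, (t, x) ∈ N → t ∈ Icc 0 T →
        i x ∈ crit D E t → t ≠ t₀ → (t - t₀) * α < 0) := by
  have hx₀ : x₀ ∈ O := hS.mem_O_of_crit ht₀ hc₀
  by_cases hdeg : IsDegenerate D E i f t₀ x₀
  · obtain ⟨v, φ, hF⟩ := hS.exists_isFold hT hTr ht₀ hdeg
    obtain ⟨δ, hδ, h1, h2, h3⟩ := hF.exists_structure
    have hmem : ∀ t x, (t, x) ∈ Metric.ball (t₀, x₀) δ → t ∈ Icc 0 T → i x ∈ crit D E t →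
        (t, x) ∈ (Icc 0 T ×ˢ O) ∩ Metric.ball (t₀, x₀) δ := fun t x hb ht hx =>
      ⟨⟨ht, hS.mem_O_of_crit ht hx⟩, hb⟩
    refine ⟨Metric.ball (t₀, x₀) δ, Metric.ball_mem_nhds _ hδ, fun x => φ (x - x₀), by fun_prop,
      fun t x hb ht hx => ⟨fun h => ?_, fun h => ?_⟩, fun t x y hbx hby ht hx hy hlt => ?_,
      fun _ => ⟨pairing i j v (fderivWithin ℝ (fun p : ℝ × X => f p.1 p.2) (Icc 0 T ×ˢ O)
        (t₀, x₀) (1, 0)), fun t x hb ht hx h => ?_⟩⟩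
    · by_contra hne
      have := (h1 (t, x) (hmem t x hb ht hx) (hS.eq_zero_of_crit ht hx)
        (fun h => hne (congrArg Prod.snd h))).2
      simp [h] at this
    · exact (h1 (t, x) (hmem t x hb ht hx) (hS.eq_zero_of_crit ht hx)
        (fun h' => h (congrArg Prod.fst h'))).1
    · have hne : x ≠ y := by rintro rfl; exact lt_irrefl _ hlt
      have hneg := h2 (t, x) (hmem t x hbx ht hx) (t, y) (hmem t y hby ht hy) rfl
        (hS.eq_zero_of_crit ht hx) (hS.eq_zero_of_crit ht hy)
        (fun h => hne (congrArg Prod.snd h))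
      have hord : ¬ 0 < φ (y - x) := fun h => by
        have := h3 (t, y) (hmem t y hby ht hy) (t, x) (hmem t x hbx ht hx) rfl
          (hS.eq_zero_of_crit ht hy) (hS.eq_zero_of_crit ht hx) h (fun w => E t (i w))
          (fun z hz => hS.energy_hasFDerivAt ht hz.2)
        exact lt_asymm hlt this
      have hφ : φ (y - x) = φ (y - x₀) - φ (x - x₀) := by rw [← map_sub]; congr 1; abel
      simp only at hneg
      rcases mul_neg_iff.1 hneg with h | h
      · exact ⟨h.2, h.1⟩
      · exact absurd (by rw [hφ]; linarith [h.1, h.2]) hord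
    · exact (h1 (t, x) (hmem t x hb ht hx) (hS.eq_zero_of_crit ht hx)
        (fun h' => h (congrArg Prod.fst h'))).2
  · have hinv : (fderiv ℝ (f t₀) x₀).IsInvertible := by
      by_contra h
      exact hdeg ⟨hc₀, h⟩
    obtain ⟨δ, hδ, h1⟩ := hS.exists_unique_near hT ht₀ hx₀ hinv
    have huniq : ∀ t x y, (t, x) ∈ Metric.ball (t₀, x₀) δ → (t, y) ∈ Metric.ball (t₀, x₀) δ →
        t ∈ Icc 0 T → i x ∈ crit D E t → i y ∈ crit D E t → x = y := fun t x y hbx hby ht hx hy =>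
      h1 t x y hbx hby ht (hS.mem_O_of_crit ht hx) (hS.mem_O_of_crit ht hy)
        (hS.eq_zero_of_crit ht hx) (hS.eq_zero_of_crit ht hy)
    -- With at most one critical point per time no energy drop is possible, so any nonvanishing
    -- constant serves as s.
    refine ⟨Metric.ball (t₀, x₀) δ, Metric.ball_mem_nhds _ hδ, fun _ => 1, continuous_const,
      fun t x hb ht hx => ⟨?_, fun _ => one_ne_zero⟩, fun t x y hbx hby ht hx hy hlt => ?_,
      fun h => absurd h hdeg⟩
    · rintro rfl
      exact huniq t x x₀ hb (Metric.mem_ball_self hδ) ht hx hc₀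
    · rw [huniq t x y hbx hby ht hx hy] at hlt
      exact absurd hlt (lt_irrefl _)

end IsSmoothSetting

end Setting

/-! ### Consequences of coercivity, power control and semiconvexity -/

section Energy

variable {H : Type*} [NormedAddCommGroup H] [InnerProductSpace ℝ H]
  {T : ℝ} {D : Set H} {E : ℝ → H → ℝ}

namespace IsAdmissibleEnergy

/-- A bound of the energy at one time gives a bound at all times (Gronwall). -/
theorem exists_sublevel (hE : IsAdmissibleEnergy T D E) (M : ℝ) :
    ∃ ρ > 0, ∀ t ∈ Icc 0 T, ∀ w ∈ D, E t w ≤ M → w ∈ sublevel T D E ρ := by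
  obtain ⟨C, hC, hP⟩ := hE.power_bound
  set m := sInf ((fun p : ℝ × H => E p.1 p.2) '' (Icc 0 T ×ˢ D)) with hm
  -- The maximum with 0 keeps R positive even when M lies well below the infimum.
  set R : ℝ := max (M - m + 1) 0 + 1 with hR
  have hR0 : 0 < R := by positivity
  refine ⟨R * Real.exp (C * T), by positivity, fun t ht w hw hM => ⟨hw, fun s hs => ?_⟩⟩
  set g : ℝ → ℝ := fun s => shifted T D E s w with hg
  have hgt : g t ≤ R := by
    have : g t = E t w - m + 1 := rfl
    rw [this, hR]
    linarith [le_max_left (M - m + 1) 0]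
  have hd : ∀ s ∈ Icc 0 T, HasDerivWithinAt g (power T E s w) (Icc 0 T) s := fun s hs =>
    (((hE.time_differentiable s hs w hw).hasDerivWithinAt).sub_const m).add_const 1
  have hexp : ∀ c s : ℝ, HasDerivAt (fun s => Real.exp (c * s)) (Real.exp (c * s) * c) s :=
    fun c s => by simpa using ((hasDerivAt_id s).const_mul c).exp
  have hd' : ∀ c : ℝ, ∀ s ∈ Ioo 0 T, HasDerivAt (fun s => g s * Real.exp (c * s))
      (power T E s w * Real.exp (c * s) + g s * (Real.exp (c * s) * c)) s := fun c s hs =>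
    ((hd s (Ioo_subset_Icc_self hs)).hasDerivAt (Icc_mem_nhds hs.1 hs.2)).mul (hexp c s)
  have hcont : ∀ c : ℝ, ContinuousOn (fun s => g s * Real.exp (c * s)) (Icc 0 T) := fun c =>
    ContinuousOn.mul (fun s hs => (hd s hs).continuousWithinAt) (by fun_prop)
  have hanti : AntitoneOn (fun s => g s * Real.exp (-C * s)) (Icc 0 T) := by
    refine antitoneOn_of_deriv_nonpos (convex_Icc _ _) (hcont _) ?_ ?_ <;> rw [interior_Icc]
    · exact fun s hs => (hd' _ s hs).differentiableAt.differentiableWithinAt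
    · intro s hs
      rw [(hd' _ s hs).deriv]
      have h1 := (abs_le.1 (hP s (Ioo_subset_Icc_self hs) w hw)).2
      have h2 : power T E s w * Real.exp (-C * s) + g s * (Real.exp (-C * s) * -C)
          = (power T E s w - C * g s) * Real.exp (-C * s) := by ring
      rw [h2]
      exact mul_nonpos_of_nonpos_of_nonneg (by simp only [hg]; linarith) (Real.exp_pos _).le
  have hmono : MonotoneOn (fun s => g s * Real.exp (C * s)) (Icc 0 T) := by
    refine monotoneOn_of_deriv_nonneg (convex_Icc _ _) (hcont _) ?_ ?_ <;> rw [interior_Icc]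
    · exact fun s hs => (hd' _ s hs).differentiableAt.differentiableWithinAt
    · intro s hs
      rw [(hd' _ s hs).deriv]
      have h1 := (abs_le.1 (hP s (Ioo_subset_Icc_self hs) w hw)).1
      have h2 : power T E s w * Real.exp (C * s) + g s * (Real.exp (C * s) * C)
          = (power T E s w + C * g s) * Real.exp (C * s) := by ring
      rw [h2]
      exact mul_nonneg (by simp only [hg]; linarith) (Real.exp_pos _).le
  have key : ∀ c : ℝ, c * (t - s) ≤ C * T → g s * Real.exp (c * s) ≤ g t * Real.exp (c * t) →
      g s ≤ R * Real.exp (C * T) := fun c hc h => by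
    have h1 : g s ≤ g t * Real.exp (c * (t - s)) := by
      have h2 : Real.exp (c * t) = Real.exp (c * (t - s)) * Real.exp (c * s) := by
        rw [← Real.exp_add]; ring_nf
      rw [h2, ← mul_assoc] at h
      exact le_of_mul_le_mul_right h (Real.exp_pos _)
    calc g s ≤ g t * Real.exp (c * (t - s)) := h1
      _ ≤ R * Real.exp (C * T) := by gcongr
  rcases le_total s t with h | h
  · exact key C (by gcongr; linarith [hs.1, ht.2]) (hmono hs ht h)
  · exact key (-C) (by nlinarith [hs.2, ht.1]) (hanti ht hs h)

/-- Quantitative minimality of critical points of semiconvex energies. -/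
theorem exists_crit_le (hE : IsAdmissibleEnergy T D E) :
    ∃ lam : ℝ, 0 ≤ lam ∧ ∀ t ∈ Icc 0 T, ∀ w ∈ crit D E t, ∀ z ∈ D,
      E t w ≤ E t z + lam / 2 * ‖z - w‖ ^ 2 := by
  obtain ⟨lam, hlam, hcv⟩ := hE.semiconvex
  refine ⟨lam, hlam, fun t ht w hw z hz => ?_⟩
  by_contra! hlt
  set c := E t w - (E t z + lam / 2 * ‖z - w‖ ^ 2) with hc
  have hc0 : 0 < c := by linarith
  -- Moving from w by r (z - w), semiconvexity makes the energy drop by at least r c, while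
  -- criticality with this ε allows at most r c / 2.
  have hpos : 0 < c / (2 * (‖z - w‖ + 1)) := by positivity
  have hline : Tendsto (fun r : ℝ => w + r • (z - w)) (𝓝[Ioc 0 1] 0) (𝓝[D] w) := by
    refine tendsto_nhdsWithin_iff.2 ⟨?_, ?_⟩
    · have : ContinuousAt (fun r : ℝ => w + r • (z - w)) 0 := by fun_prop
      have h := this.tendsto
      simp only [zero_smul, add_zero] at h
      exact h.mono_left nhdsWithin_le_nhds
    · filter_upwards [self_mem_nhdsWithin] with r hr
      exact hE.convex_domain.add_smul_sub_mem hw.1 hz ⟨hr.1.le, hr.2⟩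
  have hev := hline.eventually (hw.2.2 _ hpos)
  have hne : (𝓝[Ioc (0 : ℝ) 1] 0).NeBot := by
    rw [nhdsWithin_Ioc_eq_nhdsGT one_pos]; infer_instance
  obtain ⟨r, hr, hr1⟩ := (hev.and self_mem_nhdsWithin).exists
  simp only [add_sub_cancel_left, inner_zero_left, norm_smul, Real.norm_eq_abs,
    abs_of_pos hr1.1, zero_sub] at hr
  have hconv := (hcv t ht).2 hw.1 hz (show (0 : ℝ) ≤ 1 - r by linarith [hr1.2]) hr1.1.le
    (by ring)
  have hpt : (1 - r) • w + r • z = w + r • (z - w) := by module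
  rw [hpt] at hconv
  simp only [smul_eq_mul] at hconv
  have hsq : ‖w + r • (z - w)‖ ^ 2 = (1 - r) * ‖w‖ ^ 2 + r * ‖z‖ ^ 2
      - r * (1 - r) * ‖z - w‖ ^ 2 := by
    rw [norm_add_sq_real, norm_smul, inner_smul_right, inner_sub_right, norm_sub_sq_real,
      mul_pow, Real.norm_eq_abs, sq_abs, norm_sub_sq_real, real_inner_self_eq_norm_sq,
      real_inner_comm]
    ring
  rw [hsq] at hconv
  have h1 : c / (2 * (‖z - w‖ + 1)) * ‖z - w‖ ≤ c / 2 := by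
    rw [div_mul_eq_mul_div, div_le_div_iff₀ (by positivity) (by norm_num)]
    nlinarith [norm_nonneg (z - w)]
  have h2 : c / (2 * (‖z - w‖ + 1)) * (r * ‖z - w‖) ≤ r * (c / 2) := by
    have := mul_le_mul_of_nonneg_left h1 hr1.1.le
    linarith
  have h3 : 0 ≤ lam / 2 * r * r * ‖z - w‖ ^ 2 := by
    have := hr1.1.le; positivity
  have h4 : r * (E t z - E t w + lam / 2 * ‖z - w‖ ^ 2) = - (r * c) := by rw [hc]; ring
  have h5 : 0 < r * c := mul_pos hr1.1 hc0
  nlinarith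

theorem isClosed_sublevel (hE : IsAdmissibleEnergy T D E) (M : ℝ) :
    IsClosed {p : ℝ × H | p.1 ∈ Icc 0 T ∧ p.2 ∈ D ∧ E p.1 p.2 ≤ M} :=
  (hE.coercive M).isClosed

end IsAdmissibleEnergy

end Energy

/-! ### Isolated critical points -/

section Setting

variable {H X Y : Type*} [NormedAddCommGroup H] [InnerProductSpace ℝ H]
  [NormedAddCommGroup X] [NormedSpace ℝ X] [NormedAddCommGroup Y] [NormedSpace ℝ Y]
  {T : ℝ} {D : Set H} {E : ℝ → H → ℝ} {i : X →L[ℝ] H} {j : Y →L[ℝ] H} {O : Set X}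
  {f : ℝ → X → Y}

namespace IsSmoothSetting

/-- Critical points with bounded energy that are close in `H` are close in `X`. -/
theorem eventually_crit (hS : IsSmoothSetting T D E i j O f) (hE : IsAdmissibleEnergy T D E)
    {t₀ : ℝ} (ht₀ : t₀ ∈ Icc 0 T) {x₀ : X} (hc₀ : i x₀ ∈ crit D E t₀) (M : ℝ)
    {N : Set (ℝ × X)} (hN : N ∈ 𝓝 (t₀, x₀)) :
    ∀ᶠ p in 𝓝 (t₀, i x₀), p.1 ∈ Icc 0 T → p.2 ∈ crit D E p.1 → E p.1 p.2 ≤ M →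
      ∃ x, i x = p.2 ∧ (p.1, x) ∈ N := by
  by_contra hcon
  rw [not_eventually] at hcon
  obtain ⟨q, hq, hqn⟩ := exists_seq_forall_of_frequently hcon
  push Not at hqn
  -- One ρ must serve both the sequence and its limit, as `critical_topology` requires.
  obtain ⟨ρ, hρ, hsub⟩ := hE.exists_sublevel (max M (E t₀ (i x₀)))
  choose x hxO hx using fun n => hS.mem_of_crit (hqn n).1 (hqn n).2.1
  have h1 : Tendsto (fun n => (q n).1) atTop (𝓝 t₀) := (continuous_fst.tendsto _).comp hq
  have h2 : Tendsto (fun n => i (x n)) atTop (𝓝 (i x₀)) := by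
    simp only [hx]; exact (continuous_snd.tendsto _).comp hq
  have h3 := hS.critical_topology ρ hρ (fun n => (q n).1) x t₀ x₀
    (fun n => ⟨(hqn n).1, by
      rw [hx]
      exact ⟨(hqn n).2.1, hsub _ (hqn n).1 _ (hqn n).2.1.1
        ((hqn n).2.2.1.trans (le_max_left _ _))⟩⟩) ht₀
    ⟨hc₀, hsub _ ht₀ _ hc₀.1 (le_max_right _ _)⟩ h1 h2
  obtain ⟨n, hn⟩ := ((h1.prodMk_nhds h3).eventually hN).exists
  exact (hqn n).2.2.2 (x n) (hx n) hn

variable [CompleteSpace X] [CompleteSpace Y]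

/-- Critical points are isolated. -/
theorem eventually_eq_of_crit (hS : IsSmoothSetting T D E i j O f)
    (hE : IsAdmissibleEnergy T D E) (hT : 0 < T) (hTr : IsFullyTransversal T D E i j f)
    {t : ℝ} (ht : t ∈ Icc 0 T) {w : H} (hw : w ∈ crit D E t) :
    ∀ᶠ z in 𝓝 w, z ∈ crit D E t → z = w := by
  obtain ⟨x, hxO, rfl⟩ := hS.mem_of_crit ht hw
  obtain ⟨N, hN, s, -, h1, -⟩ := hS.exists_local_structure hT hTr ht hw
  obtain ⟨lam, hlam, hle⟩ := hE.exists_crit_le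
  -- Nearby critical points z have energy at most this: quantitative minimality of z is tested
  -- against i x, at distance at most 1.
  have h2 := hS.eventually_crit hE ht hw (E t (i x) + lam / 2) hN
  have h3 : Tendsto (fun z : H => (t, z)) (𝓝 (i x)) (𝓝 (t, i x)) :=
    (Continuous.prodMk_right t).tendsto _
  filter_upwards [h3.eventually h2, Metric.ball_mem_nhds (i x) one_pos] with z hz hzb hzc
  have h4 : ‖i x - z‖ ^ 2 ≤ 1 := by
    rw [← dist_eq_norm, dist_comm]
    exact pow_le_one₀ dist_nonneg (Metric.mem_ball.1 hzb).le
  obtain ⟨y, hy, hyN⟩ := hz ht hzc ((hle t ht z hzc _ hw.1).trans (by nlinarith))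
  rw [← hy] at hzc ⊢
  rw [(h1 t y hyN ht hzc).1 rfl]

/-- The connected components of the critical sets are singletons. -/
theorem connectedComponentIn_crit (hS : IsSmoothSetting T D E i j O f)
    (hE : IsAdmissibleEnergy T D E) (hT : 0 < T) (hTr : IsFullyTransversal T D E i j f)
    {t : ℝ} (ht : t ∈ Icc 0 T) {w : H} (hw : w ∈ crit D E t) :
    connectedComponentIn (crit D E t) w = {w} := by
  have : DiscreteTopology (crit D E t) := by
    rw [discreteTopology_subtype_iff]
    intro z hz
    rw [← empty_mem_iff_bot, mem_inf_principal, mem_nhdsWithin_iff_eventually]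
    filter_upwards [hS.eventually_eq_of_crit hE hT hTr ht hz] with y hy hyz hyc
    exact hyz (hy hyc)
  rw [connectedComponentIn_eq_image hw, connectedComponent_eq_singleton, image_singleton]

end IsSmoothSetting

end Setting

/-! ### One-sided limits and sign changes on the line -/

/-- One-sided limits of a function inherit its convergence along an open set. -/
theorem tendsto_of_tendsto_limits {H : Type*} [TopologicalSpace H] [RegularSpace H]
    {u v : ℝ → H} {s : Set ℝ} (hs : IsOpen s) {t : ℝ} {w : H} {L : ℝ → Filter ℝ}
    (hL : ∀ r, L r ≤ 𝓝 r) (hne : ∀ r, (L r).NeBot) (hu : Tendsto u (𝓝[s] t) (𝓝 w))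
    (hv : ∀ᶠ r in 𝓝[s] t, Tendsto u (L r) (𝓝 (v r))) : Tendsto v (𝓝[s] t) (𝓝 w) := by
  refine (closed_nhds_basis w).tendsto_right_iff.2 fun V hV => ?_
  have h1 := eventually_eventually_nhdsWithin.2 (hu.eventually hV.1)
  filter_upwards [h1, hv, self_mem_nhdsWithin] with r hr hvr hrs
  rw [hs.nhdsWithin_eq hrs] at hr
  have := hne r
  exact hV.2.mem_of_tendsto hvr (hr.filter_mono (hL r))

/-- If a sign can change only from negative to positive, and only at the points of `J`, while it
does change at each of them, then `J` has at most one point. -/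
theorem subsingleton_of_sign_change {a b : ℝ} {J : Set ℝ} {σl σr : ℝ → ℝ}
    (hl : ∀ t ∈ Ioo a b, σl t ≠ 0) (hJ : ∀ t ∈ Ioo a b, t ∈ J → σl t < 0 ∧ 0 < σr t)
    (hnJ : ∀ t ∈ Ioo a b, t ∉ J → σl t = σr t)
    (hleft : ∀ t ∈ Ioo a b, σl t < 0 → ∀ᶠ r in 𝓝[<] t, σr r < 0)
    (hright : ∀ t ∈ Ioo a b, 0 < σr t → ∀ᶠ r in 𝓝[>] t, 0 < σr r) :
    (J ∩ Ioo a b).Subsingleton := by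
  have key : ∀ t₁ ∈ J ∩ Ioo a b, ∀ t₂ ∈ J ∩ Ioo a b, ¬ t₁ < t₂ := by
    intro t₁ h₁ t₂ h₂ hlt
    -- Continuation argument: positivity after t₁ persists up to c = sup S. If c = t₂ it contradicts
    -- the negative left sign there; if c < t₂ it extends beyond c.
    set S := {t | t ∈ Icc t₁ t₂ ∧ ∀ r ∈ Icc t₁ t, 0 < σr r} with hS
    have h1S : t₁ ∈ S := ⟨⟨le_rfl, hlt.le⟩, fun r hr => by
      rw [le_antisymm hr.2 hr.1]; exact (hJ t₁ h₁.2 h₁.1).2⟩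
    have hbdd : BddAbove S := ⟨t₂, fun t ht => ht.1.2⟩
    set c := sSup S with hc
    have h1c : t₁ ≤ c := le_csSup hbdd h1S
    have hc2 : c ≤ t₂ := csSup_le ⟨t₁, h1S⟩ fun t ht => ht.1.2
    have hcI : c ∈ Ioo a b := ⟨h₁.2.1.trans_le h1c, hc2.trans_lt h₂.2.2⟩
    have hbelow : ∀ r, t₁ ≤ r → r < c → 0 < σr r := fun r hr hrc => by
      obtain ⟨t, htS, hrt⟩ := exists_lt_of_lt_csSup ⟨t₁, h1S⟩ hrc
      exact htS.2 r ⟨hr, hrt.le⟩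
    have hlc : t₁ < c → 0 < σl c := fun h => by
      rcases lt_or_gt_of_ne (hl c hcI) with hneg | hpos
      · obtain ⟨r, hr, hr'⟩ := ((hleft c hcI hneg).and (Ioo_mem_nhdsLT h)).exists
        exact absurd hr (hbelow r hr'.1.le hr'.2).not_gt
      · exact hpos
    have hcσ : 0 < σr c := by
      rcases h1c.eq_or_lt with h | h
      · rw [← h]; exact (hJ t₁ h₁.2 h₁.1).2
      · have h0 := hlc h
        have hcJ : c ∉ J := fun hcJ => absurd (hJ c hcI hcJ).1 h0.not_gt
        rwa [← hnJ c hcI hcJ]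
    rcases hc2.eq_or_lt with h | h
    · have h0 := hlc (by rw [h]; exact hlt)
      rw [h] at h0
      exact absurd (hJ t₂ h₂.2 h₂.1).1 h0.not_gt
    · obtain ⟨d, hd, hdσ⟩ := (mem_nhdsGT_iff_exists_Ioo_subset' h).1 (hright c hcI hcσ)
      obtain ⟨e, hce, hed⟩ := exists_between (lt_min hd h)
      have heS : e ∈ S := ⟨⟨h1c.trans hce.le, (hed.trans_le (min_le_right _ _)).le⟩, fun r hr => by
        rcases lt_trichotomy r c with h' | h' | h'
        · exact hbelow r hr.1 h'
        · rw [h']; exact hcσ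
        · exact hdσ ⟨h', hr.2.trans_lt (hed.trans_le (min_le_left _ _))⟩⟩
      exact absurd (le_csSup hbdd heS) hce.not_ge
  intro t₁ h₁ t₂ h₂
  exact le_antisymm (not_lt.1 (key t₂ h₂ t₁ h₁)) (not_lt.1 (key t₁ h₁ t₂ h₂))

/-! ### Limits and jumps of solutions -/

section Evolution

variable {H : Type*} [NormedAddCommGroup H] [InnerProductSpace ℝ H] [MeasurableSpace H]
  {T : ℝ} {D : Set H} {E : ℝ → H → ℝ} {u : ℝ → H} {μ : Measure ℝ}

namespace IsDissipativeViscosity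

theorem exists_energy_le (hu : IsDissipativeViscosity T D E u μ) :
    ∃ M, ∀ t ∈ Icc 0 T, E t (u t) ≤ M := by
  refine ⟨E 0 (u 0) + (eVariationOn (fun t => E t (u t)) (Icc 0 T)).toReal, fun t ht => ?_⟩
  have h := hu.bounded_variation.dist_le ht (left_mem_Icc.2 (ht.1.trans ht.2))
  rw [Real.dist_eq] at h
  linarith [le_abs_self (E t (u t) - E 0 (u 0))]

/-- A curve of bounded energy converges as soon as it has at most one limit point. -/
theorem tendsto_of_upperLim_subset (hu : IsDissipativeViscosity T D E u μ)
    (hE : IsAdmissibleEnergy T D E) {l : Filter ℝ} (hl : ∀ᶠ s in l, s ∈ Icc 0 T) {w : H}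
    (hw : upperLim l u ⊆ {w}) : Tendsto u l (𝓝 w) := by
  obtain ⟨M, hM⟩ := hu.exists_energy_le
  refine ((hE.coercive M).image continuous_snd).tendsto_nhds_of_unique_mapClusterPt
    (hl.mono fun s hs => ⟨(s, u s), ⟨hs, hu.mapsTo hs, hM s hs⟩, rfl⟩) fun x _ hx => hw hx

/-- Closedness of sublevels is lower semicontinuity of the energy, enough to pass an upper bound to
the limit without continuity in H. -/
theorem energy_le_of_tendsto (hu : IsDissipativeViscosity T D E u μ)
    (hE : IsAdmissibleEnergy T D E) {M : ℝ} (hM : ∀ t ∈ Icc 0 T, E t (u t) ≤ M) {l : Filter ℝ}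
    [l.NeBot] {t : ℝ} (hlt : l ≤ 𝓝 t) (hl : ∀ᶠ s in l, s ∈ Icc 0 T) {w : H}
    (hw : Tendsto u l (𝓝 w)) : E t w ≤ M := by
  have h1 : Tendsto (fun s => (s, u s)) l (𝓝 (t, w)) :=
    (tendsto_id.mono_right hlt).prodMk_nhds hw
  exact ((hE.isClosed_sublevel M).mem_of_tendsto h1
    (hl.mono fun s hs => ⟨hs, hu.mapsTo hs, hM s hs⟩)).2.2

end IsDissipativeViscosity

theorem eventually_mem_Icc_nhdsLT {T t : ℝ} (ht : t ∈ Ioc 0 T) : ∀ᶠ s in 𝓝[<] t, s ∈ Icc 0 T := by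
  filter_upwards [Ioo_mem_nhdsLT ht.1] with s hs using ⟨hs.1.le, hs.2.le.trans ht.2⟩

theorem eventually_mem_Icc_nhdsGT {T t : ℝ} (ht : t ∈ Ico 0 T) : ∀ᶠ s in 𝓝[>] t, s ∈ Icc 0 T := by
  filter_upwards [Ioo_mem_nhdsGT ht.2] with s hs using ⟨ht.1.trans hs.1.le, hs.2.le⟩

variable {X Y : Type*} [NormedAddCommGroup X] [NormedSpace ℝ X] [CompleteSpace X]
  [NormedAddCommGroup Y] [NormedSpace ℝ Y] [CompleteSpace Y]
  {i : X →L[ℝ] H} {j : Y →L[ℝ] H} {O : Set X} {f : ℝ → X → Y}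

namespace IsDissipativeViscosity

/-- A trace is a single point because components are, so inclusion of limit points becomes
convergence. -/
theorem of_isLeftTrace (hu : IsDissipativeViscosity T D E u μ) (hE : IsAdmissibleEnergy T D E)
    (hS : IsSmoothSetting T D E i j O f) (hT : 0 < T) (hTr : IsFullyTransversal T D E i j f)
    {t : ℝ} (ht : t ∈ Ioc 0 T) {U : Set H} (hU : IsLeftTrace D E u t U) :
    ∃ w ∈ crit D E t, Tendsto u (𝓝[<] t) (𝓝 w) ∧
      Tendsto (fun s => E s (u s)) (𝓝[<] t) (𝓝 (E t w)) := by
  rcases hU with ⟨h0, -⟩ | ⟨-, ⟨w, hw, rfl⟩, hlim, hen⟩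
  · exact absurd h0 ht.1.ne'
  rw [hS.connectedComponentIn_crit hE hT hTr ⟨ht.1.le, ht.2⟩ hw] at hlim hen
  rw [nhdsWithin_Ico_eq_nhdsLT ht.1] at hlim
  refine ⟨w, hw, hu.tendsto_of_upperLim_subset hE (eventually_mem_Icc_nhdsLT ht) hlim, ?_⟩
  rcases hen w rfl with ⟨h0, -⟩ | ⟨-, h⟩
  · exact absurd h0 ht.1.ne'
  · rwa [nhdsWithin_Ico_eq_nhdsLT ht.1] at h

theorem of_isRightTrace (hu : IsDissipativeViscosity T D E u μ) (hE : IsAdmissibleEnergy T D E)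
    (hS : IsSmoothSetting T D E i j O f) (hT : 0 < T) (hTr : IsFullyTransversal T D E i j f)
    {t : ℝ} (ht : t ∈ Ico 0 T) {U : Set H} (hU : IsRightTrace T D E u t U) :
    ∃ w ∈ crit D E t, Tendsto u (𝓝[>] t) (𝓝 w) ∧
      Tendsto (fun s => E s (u s)) (𝓝[>] t) (𝓝 (E t w)) := by
  rcases hU with ⟨h0, -⟩ | ⟨-, ⟨w, hw, rfl⟩, hlim, hen⟩
  · exact absurd h0 ht.2.ne
  rw [hS.connectedComponentIn_crit hE hT hTr ⟨ht.1, ht.2.le⟩ hw] at hlim hen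
  rw [nhdsWithin_Ioc_eq_nhdsGT ht.2] at hlim
  refine ⟨w, hw, hu.tendsto_of_upperLim_subset hE (eventually_mem_Icc_nhdsGT ht) hlim, ?_⟩
  rcases hen w rfl with ⟨h0, -⟩ | ⟨-, h⟩
  · exact absurd h0 ht.2.ne
  · rwa [nhdsWithin_Ioc_eq_nhdsGT ht.2] at h

/-- The lifting of a critical u(t) is just {u(t)}, so condition 2 becomes continuity. -/
theorem tendsto_of_notMem_jumpSet (hu : IsDissipativeViscosity T D E u μ)
    (hE : IsAdmissibleEnergy T D E) (hS : IsSmoothSetting T D E i j O f) (hT : 0 < T)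
    (hTr : IsFullyTransversal T D E i j f) {t : ℝ} (ht : t ∈ Icc 0 T) (hJ : t ∉ jumpSet T μ) :
    Tendsto u (𝓝[Icc 0 T \ {t}] t) (𝓝 (u t)) := by
  obtain ⟨hc, hlim⟩ := hu.critical t ⟨ht, hJ⟩
  rw [lifting, if_pos hc, hS.connectedComponentIn_crit hE hT hTr ht hc] at hlim
  refine hu.tendsto_of_upperLim_subset hE ?_ hlim
  filter_upwards [self_mem_nhdsWithin] with s hs using hs.1

/-- Existence of left limits, which are critical. -/
theorem exists_leftLim (hu : IsDissipativeViscosity T D E u μ)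
    (hE : IsAdmissibleEnergy T D E) (hS : IsSmoothSetting T D E i j O f) (hT : 0 < T)
    (hTr : IsFullyTransversal T D E i j f) {t : ℝ} (ht : t ∈ Ioc 0 T) :
    ∃ w ∈ crit D E t, Tendsto u (𝓝[<] t) (𝓝 w) ∧ (t ∉ jumpSet T μ → w = u t) := by
  have htI : t ∈ Icc 0 T := ⟨ht.1.le, ht.2⟩
  by_cases hJ : t ∈ jumpSet T μ
  · obtain ⟨U, ⟨hL, -⟩, -⟩ := hu.jump t hJ
    obtain ⟨w, hw, hlim, -⟩ := hu.of_isLeftTrace hE hS hT hTr ht hL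
    exact ⟨w, hw, hlim, fun h => absurd hJ h⟩
  · refine ⟨u t, (hu.critical t ⟨htI, hJ⟩).1,
      (hu.tendsto_of_notMem_jumpSet hE hS hT hTr htI hJ).mono_left ?_, fun _ => rfl⟩
    refine le_inf nhdsWithin_le_nhds (le_principal_iff.2 ?_)
    filter_upwards [eventually_mem_Icc_nhdsLT ht, self_mem_nhdsWithin] with s hs hst
    exact ⟨hs, ne_of_lt hst⟩

/-- Existence of right limits, which are critical. -/
theorem exists_rightLim (hu : IsDissipativeViscosity T D E u μ)
    (hE : IsAdmissibleEnergy T D E) (hS : IsSmoothSetting T D E i j O f) (hT : 0 < T)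
    (hTr : IsFullyTransversal T D E i j f) {t : ℝ} (ht : t ∈ Ico 0 T) :
    ∃ w ∈ crit D E t, Tendsto u (𝓝[>] t) (𝓝 w) ∧ (t ∉ jumpSet T μ → w = u t) := by
  have htI : t ∈ Icc 0 T := ⟨ht.1, ht.2.le⟩
  by_cases hJ : t ∈ jumpSet T μ
  · obtain ⟨U, ⟨-, hR, -⟩, -⟩ := hu.jump t hJ
    obtain ⟨w, hw, hlim, -⟩ := hu.of_isRightTrace hE hS hT hTr ht hR
    exact ⟨w, hw, hlim, fun h => absurd hJ h⟩
  · refine ⟨u t, (hu.critical t ⟨htI, hJ⟩).1,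
      (hu.tendsto_of_notMem_jumpSet hE hS hT hTr htI hJ).mono_left ?_, fun _ => rfl⟩
    refine le_inf nhdsWithin_le_nhds (le_principal_iff.2 ?_)
    filter_upwards [eventually_mem_Icc_nhdsGT ht, self_mem_nhdsWithin] with s hs hst
    exact ⟨hs, ne_of_gt hst⟩

/-- The energy drops strictly at jumps. -/
theorem energy_lt_of_mem_jumpSet (hu : IsDissipativeViscosity T D E u μ)
    (hE : IsAdmissibleEnergy T D E) (hS : IsSmoothSetting T D E i j O f) (hT : 0 < T)
    (hTr : IsFullyTransversal T D E i j f) {t : ℝ} (ht : t ∈ Ioo 0 T) (hJ : t ∈ jumpSet T μ)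
    {wl wr : H} (hwl : Tendsto u (𝓝[<] t) (𝓝 wl)) (hwr : Tendsto u (𝓝[>] t) (𝓝 wr)) :
    E t wr < E t wl := by
  obtain ⟨U, ⟨hL, hR, hpos, -, ⟨l, r, hl, hr, hlr⟩, -⟩, -⟩ := hu.jump t hJ
  obtain ⟨w, -, hlim, hen⟩ := hu.of_isLeftTrace hE hS hT hTr ⟨ht.1, ht.2.le⟩ hL
  obtain ⟨w', -, hlim', hen'⟩ := hu.of_isRightTrace hE hS hT hTr ⟨ht.1.le, ht.2⟩ hR
  rw [tendsto_nhds_unique hwl hlim, tendsto_nhds_unique hwr hlim']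
  rcases hl with ⟨h0, -⟩ | ⟨-, hl⟩
  · exact absurd h0 ht.1.ne'
  rcases hr with ⟨h0, -⟩ | ⟨-, hr⟩
  · exact absurd h0 ht.2.ne
  rw [nhdsWithin_Ico_eq_nhdsLT ht.1] at hl
  rw [nhdsWithin_Ioc_eq_nhdsGT ht.2] at hr
  rw [tendsto_nhds_unique hen hl, tendsto_nhds_unique hen' hr]
  rw [hlr, ENNReal.ofReal_pos] at hpos
  linarith

end IsDissipativeViscosity

/-- At time `t` both one-sided limits of `u` are critical points, represented by `xl` and `xr` in
the neighbourhood `N`, with energy at most `M`; they agree off the jump set and the energy drops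
at jumps. -/
structure HasLimitsIn (D : Set H) (E : ℝ → H → ℝ) (i : X →L[ℝ] H) (u : ℝ → H) (J : Set ℝ)
    (M : ℝ) (N : Set (ℝ × X)) (t : ℝ) (xl xr : X) : Prop where
  left_crit : i xl ∈ crit D E t
  right_crit : i xr ∈ crit D E t
  left_mem : (t, xl) ∈ N
  right_mem : (t, xr) ∈ N
  left_le : E t (i xl) ≤ M
  right_le : E t (i xr) ≤ M
  left_tendsto : Tendsto u (𝓝[<] t) (𝓝 (i xl))
  right_tendsto : Tendsto u (𝓝[>] t) (𝓝 (i xr))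
  eq_of_notMem : t ∉ J → i xl = i xr
  lt_of_mem : t ∈ J → E t (i xr) < E t (i xl)

namespace IsDissipativeViscosity

/-- Close to a one-sided limit of `u`, all one-sided limits of `u` lie in a given neighbourhood. -/
theorem eventually_hasLimitsIn (hu : IsDissipativeViscosity T D E u μ)
    (hE : IsAdmissibleEnergy T D E) (hS : IsSmoothSetting T D E i j O f) (hT : 0 < T)
    (hTr : IsFullyTransversal T D E i j f) {M : ℝ} (hM : ∀ t ∈ Icc 0 T, E t (u t) ≤ M)
    {t₀ : ℝ} (ht₀ : t₀ ∈ Icc 0 T) {x₀ : X} (hc₀ : i x₀ ∈ crit D E t₀) {s : Set ℝ}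
    (hs : IsOpen s) (hsT : ∀ᶠ t in 𝓝[s] t₀, t ∈ Ioo 0 T) (hlim : Tendsto u (𝓝[s] t₀) (𝓝 (i x₀)))
    {N : Set (ℝ × X)} (hN : N ∈ 𝓝 (t₀, x₀)) :
    ∀ᶠ t in 𝓝[s] t₀, ∃ xl xr, HasLimitsIn D E i u (jumpSet T μ) M N t xl xr := by
  choose! wl hwlc hwl hwlJ using fun t (ht : t ∈ Ioo 0 T) =>
    hu.exists_leftLim hE hS hT hTr ⟨ht.1, ht.2.le⟩
  choose! wr hwrc hwr hwrJ using fun t (ht : t ∈ Ioo 0 T) =>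
    hu.exists_rightLim hE hS hT hTr ⟨ht.1.le, ht.2⟩
  -- The limits at nearby times inherit the convergence of u itself, so eventually they lie in N.
  have hl : Tendsto wl (𝓝[s] t₀) (𝓝 (i x₀)) :=
    tendsto_of_tendsto_limits hs (L := fun r => 𝓝[<] r) (fun r => nhdsWithin_le_nhds)
      (fun r => inferInstance) hlim (hsT.mono hwl)
  have hr : Tendsto wr (𝓝[s] t₀) (𝓝 (i x₀)) :=
    tendsto_of_tendsto_limits hs (L := fun r => 𝓝[>] r) (fun r => nhdsWithin_le_nhds)
      (fun r => inferInstance) hlim (hsT.mono hwr)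
  have hid : Tendsto (fun t : ℝ => t) (𝓝[s] t₀) (𝓝 t₀) := nhdsWithin_le_nhds
  have hev := hS.eventually_crit hE ht₀ hc₀ M hN
  filter_upwards [hsT, (hid.prodMk_nhds hl).eventually hev, (hid.prodMk_nhds hr).eventually hev]
    with t ht h1 h2
  have htI := Ioo_subset_Icc_self ht
  have hle := hu.energy_le_of_tendsto hE hM nhdsWithin_le_nhds
    (eventually_mem_Icc_nhdsLT ⟨ht.1, ht.2.le⟩) (hwl t ht)
  have hre := hu.energy_le_of_tendsto hE hM nhdsWithin_le_nhds
    (eventually_mem_Icc_nhdsGT ⟨ht.1.le, ht.2⟩) (hwr t ht)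
  obtain ⟨xl, hxl, hxlN⟩ := h1 htI (hwlc t ht) hle
  obtain ⟨xr, hxr, hxrN⟩ := h2 htI (hwrc t ht) hre
  refine ⟨xl, xr, ?_, ?_, hxlN, hxrN, ?_, ?_, ?_, ?_, fun h => ?_, fun h => ?_⟩ <;>
    simp only [hxl, hxr]
  · exact hwlc t ht
  · exact hwrc t ht
  · exact hle
  · exact hre
  · exact hwl t ht
  · exact hwr t ht
  · rw [hwlJ t ht h, hwrJ t ht h]
  · exact hu.energy_lt_of_mem_jumpSet hE hS hT hTr ht h (hwl t ht) (hwr t ht)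

/-- Jumps do not accumulate at a one-sided limit of `u`. -/
theorem eventually_notMem_jumpSet (hu : IsDissipativeViscosity T D E u μ)
    (hE : IsAdmissibleEnergy T D E) (hS : IsSmoothSetting T D E i j O f) (hT : 0 < T)
    (hTr : IsFullyTransversal T D E i j f) {t₀ : ℝ} (ht₀ : t₀ ∈ Icc 0 T) {w : H}
    (hc₀ : w ∈ crit D E t₀) {s : Set ℝ} (hs : IsOpen s)
    (hsT : ∀ᶠ t in 𝓝[s] t₀, t ∈ Ioo 0 T) (hlim : Tendsto u (𝓝[s] t₀) (𝓝 w))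
    (hbasis : ∀ p : ℝ → Prop, (∀ᶠ t in 𝓝[s] t₀, p t) →
      ∃ a b, Ioo a b ∈ 𝓝[s] t₀ ∧ t₀ ∉ Ioo a b ∧ ∀ t ∈ Ioo a b, p t) :
    ∀ᶠ t in 𝓝[s] t₀, t ∉ jumpSet T μ := by
  obtain ⟨M, hM⟩ := hu.exists_energy_le
  obtain ⟨x₀, -, rfl⟩ := hS.mem_of_crit ht₀ hc₀
  obtain ⟨N, hN, σ, hσ, h1, h2, -⟩ := hS.exists_local_structure hT hTr ht₀ hc₀
  obtain ⟨a, b, hab, hmem, hgood⟩ := hbasis _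
    (hsT.and (hu.eventually_hasLimitsIn hE hS hT hTr hM ht₀ hc₀ hs hsT hlim hN))
  choose! xl xr hx using fun t ht => (hgood t ht).2
  have hI : ∀ t ∈ Ioo a b, t ∈ Icc 0 T := fun t ht => Ioo_subset_Icc_self (hgood t ht).1
  have hne : ∀ t ∈ Ioo a b, t ≠ t₀ := fun t ht h => hmem (h ▸ ht)
  -- Persistence of sign: near t, on the side where u tends to i x, the right limits are close to x
  -- in X, where σ is continuous.
  have hstep : ∀ t ∈ Ioo a b, ∀ x : X, i x ∈ crit D E t → ∀ P : Set ℝ, IsOpen P → σ x ∈ P →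
      ∀ s' : Set ℝ, IsOpen s' → Tendsto u (𝓝[s'] t) (𝓝 (i x)) →
      ∀ᶠ r in 𝓝[s'] t, σ (xr r) ∈ P := by
    intro t ht x hxc P hP hxP s' hs' hlim'
    have hr : ∀ᶠ r in 𝓝[s'] t, r ∈ Ioo a b := nhdsWithin_le_nhds (isOpen_Ioo.mem_nhds ht)
    have h3 : Tendsto (fun r => i (xr r)) (𝓝[s'] t) (𝓝 (i x)) :=
      tendsto_of_tendsto_limits hs' (L := fun r => 𝓝[>] r) (fun r => nhdsWithin_le_nhds)
        (fun r => inferInstance) hlim' (hr.mono fun r hr => (hx r hr).right_tendsto)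
    have hid : Tendsto (fun r : ℝ => r) (𝓝[s'] t) (𝓝 t) := nhdsWithin_le_nhds
    have hP' : {p : ℝ × X | σ p.2 ∈ P} ∈ 𝓝 (t, x) :=
      (hP.preimage (hσ.comp continuous_snd)).mem_nhds hxP
    filter_upwards [hr, (hid.prodMk_nhds h3).eventually
      (hS.eventually_crit hE (hI t ht) hxc M hP')] with r hr hr'
    obtain ⟨y, hy, hyP⟩ := hr' (hI r hr) (hx r hr).right_crit (hx r hr).right_le
    rwa [← hS.i_injective hy]
  have hsub : (jumpSet T μ ∩ Ioo a b).Subsingleton := by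
    refine subsingleton_of_sign_change (σl := fun t => σ (xl t)) (σr := fun t => σ (xr t))
      (fun t ht => ?_) (fun t ht hJ => ?_) (fun t ht hJ => ?_) (fun t ht h => ?_)
      (fun t ht h => ?_)
    · exact (h1 t _ (hx t ht).left_mem (hI t ht) (hx t ht).left_crit).2 (hne t ht)
    · exact h2 t _ _ (hx t ht).right_mem (hx t ht).left_mem (hI t ht) (hx t ht).right_crit
        (hx t ht).left_crit ((hx t ht).lt_of_mem hJ)
    · exact congrArg σ (hS.i_injective ((hx t ht).eq_of_notMem hJ))
    · exact hstep t ht _ (hx t ht).left_crit (Iio 0) isOpen_Iio h _ isOpen_Iio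
        (hx t ht).left_tendsto
    · exact hstep t ht _ (hx t ht).right_crit (Ioi 0) isOpen_Ioi h _ isOpen_Ioi
        (hx t ht).right_tendsto
  -- The interval excludes t₀, so the possible single jump in it is at positive distance from t₀.
  have hcl : (jumpSet T μ ∩ Ioo a b)ᶜ ∈ 𝓝 t₀ :=
    hsub.finite.isClosed.isOpen_compl.mem_nhds fun h => hmem h.2
  filter_upwards [hab, nhdsWithin_le_nhds hcl] with t ht ht' hJ
  exact ht' ⟨hJ, ht⟩

/-- Infinitely many jumps would accumulate somewhere in [0,T], but they can do so neither from the
left nor from the right; at an end point the outer side contains no jump times. -/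
theorem finite_jumpSet (hu : IsDissipativeViscosity T D E u μ)
    (hE : IsAdmissibleEnergy T D E) (hS : IsSmoothSetting T D E i j O f) (hT : 0 < T)
    (hTr : IsFullyTransversal T D E i j f) : (jumpSet T μ).Finite := by
  by_contra hinf
  obtain ⟨t, ht, hacc⟩ := Set.Infinite.exists_accPt_of_subset_isCompact hinf isCompact_Icc
    (fun t ht => ht.1 : jumpSet T μ ⊆ Icc 0 T)
  have hL : ∀ᶠ s in 𝓝[<] t, s ∉ jumpSet T μ := by
    rcases ht.1.eq_or_lt with h0 | h0
    · filter_upwards [self_mem_nhdsWithin] with s hs hJ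
      exact absurd hJ.1.1 (not_le.2 (h0 ▸ hs))
    · obtain ⟨w, hw, hlim, -⟩ := hu.exists_leftLim hE hS hT hTr ⟨h0, ht.2⟩
      refine hu.eventually_notMem_jumpSet hE hS hT hTr ht hw isOpen_Iio ?_ hlim fun p hp => ?_
      · filter_upwards [Ioo_mem_nhdsLT h0] with s hs using ⟨hs.1, hs.2.trans_le ht.2⟩
      · obtain ⟨a, ha, hap⟩ := (mem_nhdsLT_iff_exists_Ioo_subset' h0).1 hp
        exact ⟨a, t, Ioo_mem_nhdsLT ha, fun h => lt_irrefl _ h.2, hap⟩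
  have hR : ∀ᶠ s in 𝓝[>] t, s ∉ jumpSet T μ := by
    rcases ht.2.eq_or_lt with h0 | h0
    · filter_upwards [self_mem_nhdsWithin] with s hs hJ
      exact absurd hJ.1.2 (not_le.2 (h0 ▸ hs))
    · obtain ⟨w, hw, hlim, -⟩ := hu.exists_rightLim hE hS hT hTr ⟨ht.1, h0⟩
      refine hu.eventually_notMem_jumpSet hE hS hT hTr ht hw isOpen_Ioi ?_ hlim fun p hp => ?_
      · filter_upwards [Ioo_mem_nhdsGT h0] with s hs using ⟨ht.1.trans_lt hs.1, hs.2⟩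
      · obtain ⟨b, hb, hbp⟩ := (mem_nhdsGT_iff_exists_Ioo_subset' h0).1 hp
        exact ⟨t, b, Ioo_mem_nhdsGT hb, fun h => lt_irrefl _ h.1, hbp⟩
  rw [accPt_iff_frequently_nhdsNE] at hacc
  refine hacc ?_
  rw [← nhdsLT_sup_nhdsGT]
  exact eventually_sup.2 ⟨hL, hR⟩

/-- A curve can reach a degenerate critical point only at a jump time. -/
theorem mem_jumpSet_of_isDegenerate (hu : IsDissipativeViscosity T D E u μ)
    (hE : IsAdmissibleEnergy T D E) (hS : IsSmoothSetting T D E i j O f) (hT : 0 < T)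
    (hTr : IsFullyTransversal T D E i j f) {t : ℝ} (ht : t ∈ Ioo 0 T) {x : X}
    (hdeg : IsDegenerate D E i f t x) (hlim : Tendsto u (𝓝[<] t) (𝓝 (i x))) :
    t ∈ jumpSet T μ := by
  by_contra hJ
  have htI := Ioo_subset_Icc_self ht
  obtain ⟨w, -, hw, hwJ⟩ := hu.exists_leftLim hE hS hT hTr ⟨ht.1, ht.2.le⟩
  obtain ⟨w', -, hlim', hwJ'⟩ := hu.exists_rightLim hE hS hT hTr ⟨ht.1.le, ht.2⟩
  rw [hwJ' hJ, ← hwJ hJ, ← tendsto_nhds_unique hlim hw] at hlim'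
  obtain ⟨M, hM⟩ := hu.exists_energy_le
  obtain ⟨N, hN, σ, -, -, -, h3⟩ := hS.exists_local_structure hT hTr htI hdeg.1
  obtain ⟨α, hα⟩ := h3 hdeg
  have hmem : ∀ s : Set ℝ, ∀ᶠ r in 𝓝[s] t, r ∈ Ioo 0 T := fun s =>
    nhdsWithin_le_nhds (isOpen_Ioo.mem_nhds ht)
  -- Either side of t supplies critical points in N at times different from t, so the fold
  -- inequality must hold for both signs of r - t.
  have hside : ∀ s : Set ℝ, IsOpen s → t ∉ s → Tendsto u (𝓝[s] t) (𝓝 (i x)) →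
      ∀ᶠ r in 𝓝[s] t, (r - t) * α < 0 := fun s hs hts hl => by
    filter_upwards [hu.eventually_hasLimitsIn hE hS hT hTr hM htI hdeg.1 hs (hmem s) hl hN, hmem s,
      self_mem_nhdsWithin] with r hr hrI hrs
    obtain ⟨xl, xr, h⟩ := hr
    exact hα r xl h.left_mem (Ioo_subset_Icc_self hrI) h.left_crit fun h' => hts (h' ▸ hrs)
  obtain ⟨r, hr, hrt⟩ := ((hside _ isOpen_Iio (by simp) hlim).and self_mem_nhdsWithin).exists
  obtain ⟨q, hq, hqt⟩ := ((hside _ isOpen_Ioi (by simp) hlim').and self_mem_nhdsWithin).exists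
  have hrt : r < t := hrt
  have hqt : t < q := hqt
  have h1 : 0 < α := pos_of_mul_neg_right hr (by linarith)
  have h2 : 0 < (q - t) * α := mul_pos (by linarith) h1
  linarith

end IsDissipativeViscosity

end Evolution

end CriticalEvolution

theorem theorem7p9 {H X Y : Type*}
    [NormedAddCommGroup H] [InnerProductSpace ℝ H] [CompleteSpace H]
    [TopologicalSpace.SeparableSpace H] [MeasurableSpace H] [BorelSpace H]
    [NormedAddCommGroup X] [NormedSpace ℝ X] [CompleteSpace X]
    [TopologicalSpace.SeparableSpace X]
    [NormedAddCommGroup Y] [NormedSpace ℝ Y] [CompleteSpace Y]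
    (T : ℝ) (hT : 0 < T) (D : Set H) (E : ℝ → H → ℝ)
    (i : X →L[ℝ] H) (j : Y →L[ℝ] H) (O : Set X) (f : ℝ → X → Y)
    (hE : CriticalEvolution.IsAdmissibleEnergy T D E)
    (hS : CriticalEvolution.IsSmoothSetting T D E i j O f)
    (hTr : CriticalEvolution.IsFullyTransversal T D E i j f)
    (u : ℝ → H) (μ : Measure ℝ)
    (hu : CriticalEvolution.IsDissipativeViscosity T D E u μ) :
    (∀ t ∈ Ioo 0 T, ∃ w : H, Tendsto u (𝓝[Ico 0 t] t) (𝓝 w) ∧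
      ((∃ x : X, i x = w ∧ CriticalEvolution.IsDegenerate D E i f t x) →
        t ∈ CriticalEvolution.jumpSet T μ)) ∧
    (CriticalEvolution.jumpSet T μ).Finite := by
  refine ⟨fun t ht => ?_, hu.finite_jumpSet hE hS hT hTr⟩
  obtain ⟨w, -, hw, -⟩ := hu.exists_leftLim hE hS hT hTr ⟨ht.1, ht.2.le⟩
  rw [nhdsWithin_Ico_eq_nhdsLT ht.1]
  refine ⟨w, hw, ?_⟩
  rintro ⟨x, rfl, hdeg⟩
  exact hu.mem_jumpSet_of_isDegenerate hE hS hT hTr ht hdeg hw
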